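/- Let $I=[0,1]$. For a space $Y$ and a nonempty subset $S\subset Y$, let $Y/S$ denote the quotient space obtained by collapsing $S$ to a point. Let the Hawaiian ropes $\mathrm{HR}$ be the quotient space of the disjoint union $\coprod_{n\ge 0} I\times\{n\}=I\times\mathbb{N}_0$ by the equivalence relation generated by $(0,n)\sim(0,0)$ and $(1,n)\sim(1/n,0)$ for $n\ge 1$; let $\alpha: I\times\mathbb{N}_0\to\mathrm{HR}$ be the quotient map and $A=\bigcup_{n\ge 1}\alpha(I\times\{n\})$. Let $X=(\mathrm{HR}\times I)/(\mathrm{HR}\times\{0\})$ be the cone on $\mathrm{HR}$, with quotient map $q:\mathrm{HR}\times I\to X$, let $A'=q(A\times\{1\})\subset X$, and let $\pi:X\to X/A'$ be the quotient map. Then: 1. $X$ is contractible, locally contractible (every point has a neighborhood basis of contractible open sets), Hausdorff and normal, but not metrizable. 2. $A'$ is closed in $X$ and is weakly contractible: it is nonempty and path connected, and all its homotopy groups $\pi_n$, $n\ge 1$, are trivial at every basepoint. 3. The first singular homology group $H_1(X/A';\mathbb{Z})$ is uncountable. 4. Consequently $\pi_1$ can be created by collapsing a closed weakly contractible subspace of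 a contractible space: $\pi_1(X,x)$ is trivial for every $x\in X$, $\pi_1(X/A',y)$ is uncountable for every $y\in X/A'$, and $\pi_\sharp:\pi_1(X,x)\to\pi_1(X/A',\pi(x))$ is not surjective for any $x\in X$. -/

import Mathlib

open scoped Topology unitInterval

namespace HawaiianRopes

/-- The quotient space `Y / S` obtained from `Y` by collapsing the (nonempty) subset `S` to a
point, with the quotient topology. -/
abbrev Collapse {Y : Type*} [TopologicalSpace Y] (S : Set Y) : Type _ :=
  Quot (fun x y : Y => x ∈ S ∧ y ∈ S)

/-- The canonical quotient map `Y → Y / S`. -/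
def collapseMap {Y : Type*} [TopologicalSpace Y] (S : Set Y) : C(Y, Collapse S) :=
  ⟨Quot.mk _, continuous_quot_mk⟩

/-- The identifications on `I × ℕ`, the disjoint union of countably many unit intervals:
`(0, n) ∼ (0, 0)` and `(1, n) ∼ (1/n, 0)` for `n ≥ 1`. -/
inductive RopeRel : I × ℕ → I × ℕ → Prop
  | start (n : ℕ) (hn : 1 ≤ n) : RopeRel (0, n) (0, 0)
  | finish (n : ℕ) (hn : 1 ≤ n) (s : I) (hs : (s : ℝ) = 1 / (n : ℝ)) : RopeRel (1, n) (s, 0)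

/-- The Hawaiian ropes: the quotient of `I × ℕ` by the equivalence relation generated by
`RopeRel`, with the quotient topology. -/
abbrev HR : Type := Quot RopeRel

/-- The quotient map from the disjoint union of intervals onto the Hawaiian ropes. -/
def alpha : C(I × ℕ, HR) := ⟨Quot.mk RopeRel, continuous_quot_mk⟩

/-- The union of all the ropes: the images of the intervals with index `n ≥ 1`. -/
def A : Set HR := ⋃ n ≥ 1, alpha '' (Set.univ ×ˢ {n})

/-- The cone `HR × I / HR × {0}` on the Hawaiian ropes. -/
abbrev X : Type := Collapse (Set.univ ×ˢ {0} : Set (HR × I))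

/-- The quotient map `HR × I → X`. -/
def q : C(HR × I, X) := collapseMap (Set.univ ×ˢ {0})

/-- The copy `q (A × {1})` of `A` in the base of the cone. -/
def A' : Set X := q '' (A ×ˢ {1})

/-- A space is weakly contractible if it is nonempty and all its homotopy sets `π_n`, `n ≥ 0`, at
all basepoints are trivial (for `n = 0` this says that the space is path connected). -/
def WeaklyContractible (Y : Type*) [TopologicalSpace Y] : Prop :=
  Nonempty Y ∧ ∀ (n : ℕ) (y : Y), Subsingleton (HomotopyGroup.Pi n Y y)

/-- The first singular homology group of a space with integer coefficients. -/
noncomputable def H1 (Y : Type) [TopologicalSpace Y] : ModuleCat.{0} ℤ :=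
  ((AlgebraicTopology.singularHomologyFunctor (ModuleCat.{0} ℤ) 1).obj (ModuleCat.of ℤ ℤ)).obj
    (TopCat.of Y)

end HawaiianRopes

/-! In `Collapse A'` the points `1/n` and `0` of the base interval become one point, so each gap
between `1/(n+1)` and `1/n` closes up to a loop, and many gaps can be run through in a single loop
(`gapLoop`). To tell such loops apart, `winding m` maps the quotient to `ℂ`. At the top of the cone
it turns once around the origin along the gap below `1/m`; over rope `m` it is the straight-line
homotopy from the constant `1` to `exp (2πit)`. It equals `1` on the collapsed sets, so it descends,
at the price of one zero in the strip over that rope. The continuous function `detect` takes the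
value `2m` at this zero, so a compact set contains the zeros of only finitely many `winding m`. Thus
on the image of a square or a 2-simplex almost all of these functions have logarithms, and the germ
at infinity of the sequence of logarithmic increments (`logGerm`) is a homotopy invariant and a
1-cocycle. Binary sequences with every entry repeated infinitely often are recovered from this germ,
which gives uncountably many classes in `π₁` and in `H₁`.

`A'` is weakly contractible although the ropes cannot all be pulled back to their starting point at
once: the ends `1/n` tend to `0` and would sweep over entire ropes. A compact connected set in `A`
has bounded `height`, hence passes the midpoint of only finitely many ropes. It suffices to pull
these completely and the first half of each of the others (`exists_ropeContraction`).

The cone `X` is contractible towards its vertex, and locally contractible because the short ends of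
the ropes retract to the base interval. Normality is obtained on `HR` by extension rope by rope and
transported along the closed map `q`. First countability fails since a function on `HR` may have
arbitrary heights on the ropes (`ropeBump`). -/

namespace HawaiianRopes

/-! ### Detecting classes in first homology by cocycles -/

section SingularHomology

open CategoryTheory AlgebraicTopology Simplicial

/-- The inclusion of the face opposite to the `i`-th vertex of a simplex. -/
noncomputable def faceMap (n : ℕ) (i : Fin (n + 2)) :
    C(stdSimplex ℝ (Fin (n + 1)), stdSimplex ℝ (Fin (n + 2))) :=
  ⟨stdSimplex.map (Fin.succAbove i), stdSimplex.continuous_map _⟩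

theorem toSSetObjEquiv_δ (Y : TopCat.{0}) (n : ℕ) (i : Fin (n + 2))
    (x : (TopCat.toSSet.obj Y) _⦋n+1⦌) :
    Y.toSSetObjEquiv _ ((TopCat.toSSet.obj Y).δ i x) =
      (Y.toSSetObjEquiv _ x).comp (faceMap n i) := rfl

/-- A function on singular `1`-simplices which satisfies the cocycle condition induces a function on
the first homology group. -/
theorem exists_H1_map {Y : Type} [TopologicalSpace Y] {G : Type} [AddCommGroup G]
    (Φ : C(stdSimplex ℝ (Fin 2), Y) → G)
    (hΦ : ∀ w : C(stdSimplex ℝ (Fin 3), Y),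
      Φ (w.comp (faceMap 1 0)) - Φ (w.comp (faceMap 1 1)) + Φ (w.comp (faceMap 1 2)) = 0) :
    ∃ F : H1 Y → G, ∀ w : C(stdSimplex ℝ (Fin 2), Y), w.comp (faceMap 0 0) = w.comp (faceMap 0 1) →
      Φ w ∈ Set.range F := by
  let T := TopCat.of Y
  let S := TopCat.toSSet.obj T
  let K := S.chainComplex (ModuleCat.of ℤ ℤ)
  let φ : K.X 1 ⟶ ModuleCat.of ℤ G :=
    Limits.Cofan.IsColimit.desc (S.isColimitChainComplexXCofan (ModuleCat.of ℤ ℤ) 1)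
      fun x => ModuleCat.ofHom (LinearMap.toSpanSingleton ℤ G (Φ (T.toSSetObjEquiv _ x)))
  have hφ : ∀ x : S _⦋1⦌, S.ιChainComplex x ≫ φ = ModuleCat.ofHom
      (LinearMap.toSpanSingleton ℤ G (Φ (T.toSSetObjEquiv _ x))) := fun x =>
    Limits.Cofan.IsColimit.fac (S.isColimitChainComplexXCofan (ModuleCat.of ℤ ℤ) 1) _ x
  have hd : K.d 2 1 ≫ φ = 0 := by
    apply SSet.chainComplex_hom_ext
    intro x
    rw [SSet.ιChainComplex_d_assoc]
    simp only [Limits.comp_zero, Preadditive.sum_comp, Preadditive.zsmul_comp, hφ]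
    have h : Φ (T.toSSetObjEquiv (.op ⦋1⦌) (S.δ 0 x)) - Φ (T.toSSetObjEquiv (.op ⦋1⦌) (S.δ 1 x)) +
        Φ (T.toSSetObjEquiv (.op ⦋1⦌) (S.δ 2 x)) = 0 := hΦ (T.toSSetObjEquiv _ x)
    ext
    simpa [Fin.sum_univ_three, sub_eq_add_neg, T] using h
  let F : K.homology 1 ⟶ ModuleCat.of ℤ G := K.homologyι 1 ≫ K.descOpcycles φ 2 (by simp) hd
  refine ⟨F, fun w hw => ?_⟩
  let x : S _⦋1⦌ := (T.toSSetObjEquiv (.op ⦋1⦌)).symm w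
  have hx : S.ιChainComplex (R := ModuleCat.of ℤ ℤ) x ≫ K.d 1 0 = 0 := by
    have h : S.δ 0 x = S.δ 1 x := by
      apply (T.toSSetObjEquiv _).injective
      refine (toSSetObjEquiv_δ T 0 0 x).trans (Eq.trans ?_ (toSSetObjEquiv_δ T 0 1 x).symm)
      rw [show T.toSSetObjEquiv _ x = w from Equiv.apply_symm_apply _ _]
      exact hw
    rw [SSet.ιChainComplex_d, Fin.sum_univ_two, h]
    simp
  -- The homology class of the loop, as a morphism from `ℤ`; its value at `1` is the required
  -- preimage.
  let c : ModuleCat.of ℤ ℤ ⟶ K.homology 1 :=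
    K.liftCycles (S.ιChainComplex x) 0 (by simp) hx ≫ K.homologyπ 1
  have : c ≫ F = ModuleCat.ofHom (LinearMap.toSpanSingleton ℤ G (Φ w)) := by
    simp [c, F, hφ, x]
  refine ⟨c (1 : ℤ), ?_⟩
  have := congr($this (1 : ℤ))
  simpa using this

end SingularHomology

/-! ### Logarithmic increments and their germs at infinity -/

open Filter

instance : ContractibleSpace I := (convex_Icc (0 : ℝ) 1).contractibleSpace ⟨0, by simp⟩

instance : LocallyPathConnectedSpace I := (convex_Icc (0 : ℝ) 1).locallyPathConnectedSpace

/-- The increment along a path in `ℂ` of a continuous branch of the logarithm; it is `0` if there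
is no such branch. -/
noncomputable def logIncrement (f : C(I, ℂ)) : ℂ :=
  open Classical in
  if h : ∃ L : C(I, ℂ), ∀ x, Complex.exp (L x) = f x then h.choose 1 - h.choose 0 else 0

theorem exists_continuousMap_exp_eq {K : Type*} [TopologicalSpace K] [SimplyConnectedSpace K]
    [LocallyPathConnectedSpace K] (f : C(K, ℂ)) (hf : ∀ x, f x ≠ 0) :
    ∃ L : C(K, ℂ), ∀ x, Complex.exp (L x) = f x := by
  obtain ⟨x₀⟩ : Nonempty K := inferInstance
  obtain ⟨F, ⟨-, hF⟩, -⟩ := Complex.isCoveringMapOn_exp.existsUnique_continuousMap_lifts f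
    (Complex.exp_log (hf x₀)) hf
  exact ⟨F, fun x => congrFun hF x⟩

/-- The chosen branch, shifted by a constant so as to agree with `L` at `0`, is another lift of `f`
through the exponential covering, so uniqueness of lifts applies. -/
theorem logIncrement_eq {f : C(I, ℂ)} (L : C(I, ℂ)) (hL : ∀ x, Complex.exp (L x) = f x) :
    logIncrement f = L 1 - L 0 := by
  have h : ∃ L : C(I, ℂ), ∀ x, Complex.exp (L x) = f x := ⟨L, hL⟩
  have hne : ∀ x, f x ≠ 0 := fun x => hL x ▸ Complex.exp_ne_zero _
  rw [logIncrement, dif_pos h]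
  set M := h.choose with hM
  have hM' : ∀ x, Complex.exp (M x) = f x := h.choose_spec
  obtain ⟨F, -, hF⟩ := Complex.isCoveringMapOn_exp.existsUnique_continuousMap_lifts f
    (hL 0) hne
  have h1 := hF L ⟨rfl, funext hL⟩
  have h2 := hF (M + ContinuousMap.const _ (L 0 - M 0)) ⟨by simp, funext fun x => by
    simp [Complex.exp_add, Complex.exp_sub, hM', hL, hne]⟩
  have := DFunLike.congr_fun (h1.trans h2.symm) 1
  simp only [ContinuousMap.add_apply, ContinuousMap.const_apply] at this
  rw [this]; ring

section LogGerm

variable {Y : Type} [TopologicalSpace Y] (Γ : ℕ → C(Y, ℂ))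

/-- The germ at infinity of the sequence of logarithmic increments along a path of a sequence of
complex functions. -/
noncomputable def logGerm (p : C(I, Y)) : (atTop : Filter ℕ).Germ ℂ :=
  ((fun k => logIncrement ((Γ k).comp p) : ℕ → ℂ) : (atTop : Filter ℕ).Germ ℂ)

variable {Γ}

/-- For large `k` the function `Γ k ∘ w` has no zero on the compact space `K` and hence a global
logarithm; the germ of these logarithms is a potential. The finitely many bad indices, where the
choice is `0`, do not affect the germ. Homotopy invariance and the cocycle condition both follow
from this with `K` a square or a 2-simplex. -/
theorem exists_logGerm_potential (hΓ : ∀ K : Set Y, IsCompact K → ∀ᶠ k in atTop, ∀ y ∈ K, Γ k y ≠ 0)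
    {K : Type*} [TopologicalSpace K] [CompactSpace K] [SimplyConnectedSpace K]
    [LocallyPathConnectedSpace K] (w : C(K, Y)) :
    ∃ l : K → (atTop : Filter ℕ).Germ ℂ, ∀ p : C(I, K),
      logGerm Γ (w.comp p) = l (p 1) - l (p 0) := by
  have h (k : ℕ) : ∃ L : C(K, ℂ), (∀ x, Γ k (w x) ≠ 0) → ∀ x, Complex.exp (L x) = Γ k (w x) := by
    by_cases hk : ∀ x, Γ k (w x) ≠ 0
    · obtain ⟨L, hL⟩ := exists_continuousMap_exp_eq ((Γ k).comp w) hk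
      exact ⟨L, fun _ => hL⟩
    · exact ⟨0, fun h => absurd h hk⟩
  choose L hL using h
  refine ⟨fun x => ((fun k => L k x : ℕ → ℂ) : (atTop : Filter ℕ).Germ ℂ), fun p => ?_⟩
  rw [← Germ.coe_sub]
  refine Germ.coe_eq.2 ?_
  filter_upwards [hΓ _ (isCompact_range w.continuous)] with k hk
  exact logIncrement_eq ((L k).comp p) fun x => hL k (fun x => hk _ ⟨x, rfl⟩) _

theorem logGerm_eq_of_homotopic
    (hΓ : ∀ K : Set Y, IsCompact K → ∀ᶠ k in atTop, ∀ y ∈ K, Γ k y ≠ 0)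
    {x y : Y} {p p' : Path x y} (h : p.Homotopic p') :
    logGerm Γ p.toContinuousMap = logGerm Γ p'.toContinuousMap := by
  obtain ⟨H⟩ := h
  have hconst (z : Y) : logGerm Γ (ContinuousMap.const I z) = 0 := by
    obtain ⟨l, hl⟩ := exists_logGerm_potential hΓ (ContinuousMap.const I z)
    simpa using hl (ContinuousMap.const I 0)
  have : SimplyConnectedSpace (I × I) := inferInstance
  have : LocallyPathConnectedSpace (I × I) := inferInstance
  obtain ⟨l, hl⟩ := exists_logGerm_potential hΓ H.toContinuousMap
  have e0 := hl (.prodMk (.const I 0) (.id I))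
  have e1 := hl (.prodMk (.const I 1) (.id I))
  have e2 := hl (.prodMk (.id I) (.const I 0))
  have e3 := hl (.prodMk (.id I) (.const I 1))
  have f0 : H.toContinuousMap.comp (.prodMk (.const I 0) (.id I)) = p.toContinuousMap := by
    ext t; simp
  have f1 : H.toContinuousMap.comp (.prodMk (.const I 1) (.id I)) = p'.toContinuousMap := by
    ext t; simp
  have f2 : H.toContinuousMap.comp (.prodMk (.id I) (.const I 0)) = .const I x := by
    ext t; simp
  have f3 : H.toContinuousMap.comp (.prodMk (.id I) (.const I 1)) = .const I y := by
    ext t; simp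
  rw [f0] at e0
  rw [f1] at e1
  rw [f2, hconst] at e2
  rw [f3, hconst] at e3
  simp only [ContinuousMap.prod_eval, ContinuousMap.const_apply, ContinuousMap.id_apply] at *
  rw [e0, e1, ← sub_eq_zero.1 e2.symm, ← sub_eq_zero.1 e3.symm]

theorem uncountable_fundamentalGroup
    (hΓ : ∀ K : Set Y, IsCompact K → ∀ᶠ k in atTop, ∀ y ∈ K, Γ k y ≠ 0)
    {ι : Type*} [Uncountable ι] {y : Y} (p : ι → Path y y)
    (hp : Function.Injective fun i => logGerm Γ (p i).toContinuousMap) :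
    Uncountable (FundamentalGroup Y y) := by
  have : Function.Injective fun i =>
      FundamentalGroup.fromPath (Path.Homotopic.Quotient.mk (p i)) := by
    intro i j hij
    exact hp (logGerm_eq_of_homotopic hΓ (Path.Homotopic.Quotient.exact hij))
  exact this.uncountable

theorem uncountable_H1
    (hΓ : ∀ K : Set Y, IsCompact K → ∀ᶠ k in atTop, ∀ y ∈ K, Γ k y ≠ 0)
    {ι : Type*} [Uncountable ι] {y : Y} (p : ι → Path y y)
    (hp : Function.Injective fun i => logGerm Γ (p i).toContinuousMap) :
    Uncountable (H1 Y) := by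
  let h : C(I, stdSimplex ℝ (Fin 2)) := stdSimplexHomeomorphUnitInterval.symm
  let h' : C(stdSimplex ℝ (Fin 2), I) := stdSimplexHomeomorphUnitInterval
  have h0 : h 0 = stdSimplex.vertex 0 :=
    stdSimplexHomeomorphUnitInterval.symm_apply_eq.2 stdSimplexHomeomorphUnitInterval_zero.symm
  have h1 : h 1 = stdSimplex.vertex 1 :=
    stdSimplexHomeomorphUnitInterval.symm_apply_eq.2 stdSimplexHomeomorphUnitInterval_one.symm
  have hh : h'.comp h = .id I := by
    ext1 x; exact stdSimplexHomeomorphUnitInterval.apply_symm_apply x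
  obtain ⟨F, hF⟩ := exists_H1_map (Y := Y) (fun w => logGerm Γ (w.comp h)) fun w => by
    have hc := convex_stdSimplex ℝ (Fin 3)
    have := hc.locallyPathConnectedSpace
    have := hc.contractibleSpace ⟨_, (stdSimplex.vertex 0).2⟩
    have : CompactSpace (stdSimplex ℝ (Fin 3)) := inferInstance
    have : SimplyConnectedSpace (stdSimplex ℝ (Fin 3)) := inferInstance
    obtain ⟨l, hl⟩ := exists_logGerm_potential hΓ w
    have key (i : Fin 3) : logGerm Γ ((w.comp (faceMap 1 i)).comp h) =
        l (stdSimplex.vertex (i.succAbove 1)) - l (stdSimplex.vertex (i.succAbove 0)) := by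
      rw [ContinuousMap.comp_assoc, hl]
      simp only [ContinuousMap.comp_apply, h0, h1, faceMap, ContinuousMap.coe_mk,
        stdSimplex.map_vertex]
    simp only [key]
    have a : (0 : Fin 3).succAbove (1 : Fin 2) = 2 := rfl
    have b : (0 : Fin 3).succAbove (0 : Fin 2) = 1 := rfl
    have c : (1 : Fin 3).succAbove (1 : Fin 2) = 2 := rfl
    have d : (1 : Fin 3).succAbove (0 : Fin 2) = 0 := rfl
    have e : (2 : Fin 3).succAbove (1 : Fin 2) = 1 := rfl
    have f : (2 : Fin 3).succAbove (0 : Fin 2) = 0 := rfl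
    rw [a, b, c, d, e, f]
    abel
  have hmem (i : ι) : logGerm Γ (p i).toContinuousMap ∈ Set.range F := by
    have := hF ((p i).toContinuousMap.comp h') ?_
    · rwa [ContinuousMap.comp_assoc, hh, ContinuousMap.comp_id] at this
    · ext x
      obtain rfl : x = stdSimplex.vertex 0 := Subsingleton.elim _ _
      simp only [ContinuousMap.comp_apply, faceMap, ContinuousMap.coe_mk, stdSimplex.map_vertex]
      have e0 : h' (stdSimplex.vertex ((0 : Fin 2).succAbove 0)) = 1 :=
        stdSimplexHomeomorphUnitInterval_one
      have e1 : h' (stdSimplex.vertex ((1 : Fin 2).succAbove 0)) = 0 :=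
        stdSimplexHomeomorphUnitInterval_zero
      rw [e0, e1]
      simp
  choose z hz using hmem
  have : Function.Injective z := fun i j hij => hp (by
    change logGerm Γ (p i).toContinuousMap = logGerm Γ (p j).toContinuousMap
    rw [← hz i, ← hz j, hij])
  exact this.uncountable

end LogGerm

/-! ### Maps out of the quotients -/

/-- The map induced on the quotient `Y / S` by a map which is constant on `S`. -/
def Collapse.lift {Y Z : Type*} [TopologicalSpace Y] [TopologicalSpace Z] {S : Set Y} (f : C(Y, Z))
    (h : ∀ x ∈ S, ∀ y ∈ S, f x = f y) : C(Collapse S, Z) :=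
  ⟨Quot.lift f fun x y hxy => h x hxy.1 y hxy.2, continuous_quot_lift _ f.continuous⟩

theorem collapseMap_surjective {Y : Type*} [TopologicalSpace Y] (S : Set Y) :
    Function.Surjective (collapseMap S) := Quot.mk_surjective

theorem collapseMap_eq {Y : Type*} [TopologicalSpace Y] {S : Set Y} {x y : Y} (hx : x ∈ S)
    (hy : y ∈ S) : collapseMap S x = collapseMap S y := Quot.sound ⟨hx, hy⟩

/-- The point `1 / n` of the unit interval. -/
noncomputable def unitFrac (n : ℕ) : I :=
  ⟨1 / n, by positivity, by simpa using Nat.cast_inv_le_one n⟩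

theorem coe_unitFrac (n : ℕ) : (unitFrac n : ℝ) = 1 / n := rfl

theorem alpha_surjective : Function.Surjective alpha := Quot.mk_surjective

theorem alpha_zero (n : ℕ) : alpha (0, n) = alpha (0, 0) := by
  rcases Nat.eq_zero_or_pos n with rfl | hn
  · rfl
  · exact Quot.sound (.start n hn)

theorem alpha_one {n : ℕ} (hn : 1 ≤ n) : alpha (1, n) = alpha (unitFrac n, 0) :=
  Quot.sound (.finish n hn _ rfl)

/-- Compatible maps on the base interval and on the ropes define a map on the Hawaiian ropes. -/
def HR.lift {Z : Type*} [TopologicalSpace Z] (f : ℕ → C(I, Z)) (h₀ : ∀ n ≥ 1, f n 0 = f 0 0)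
    (h₁ : ∀ n ≥ 1, f n 1 = f 0 (unitFrac n)) : C(HR, Z) :=
  ⟨Quot.lift (fun p => f p.2 p.1) (by
    rintro _ _ (⟨n, hn⟩ | ⟨n, hn, s, hs⟩)
    · exact h₀ n hn
    · obtain rfl : s = unitFrac n := Subtype.ext hs
      exact h₁ n hn),
   continuous_quot_lift _ (continuous_prod_of_discrete_right.2 fun n => (f n).continuous)⟩

@[simp]
theorem HR.lift_alpha {Z : Type*} [TopologicalSpace Z] (f : ℕ → C(I, Z))
    (h₀ : ∀ n ≥ 1, f n 0 = f 0 0) (h₁ : ∀ n ≥ 1, f n 1 = f 0 (unitFrac n)) (s : I) (n : ℕ) :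
    HR.lift f h₀ h₁ (alpha (s, n)) = f n s := rfl

/-- Compatible families of maps on the base interval and on the ropes define a map on the product
of the Hawaiian ropes with an interval. -/
def HR.liftProd {Z : Type*} [TopologicalSpace Z] (f : ℕ → C(I × I, Z))
    (h₀ : ∀ n ≥ 1, ∀ t, f n (0, t) = f 0 (0, t))
    (h₁ : ∀ n ≥ 1, ∀ t, f n (1, t) = f 0 (unitFrac n, t)) : C(HR × I, Z) :=
  (HR.lift (fun n => (f n).curry) (fun n hn => ContinuousMap.ext (h₀ n hn))
    (fun n hn => ContinuousMap.ext (h₁ n hn))).uncurry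

@[simp]
theorem HR.liftProd_alpha {Z : Type*} [TopologicalSpace Z] (f : ℕ → C(I × I, Z))
    (h₀ : ∀ n ≥ 1, ∀ t, f n (0, t) = f 0 (0, t))
    (h₁ : ∀ n ≥ 1, ∀ t, f n (1, t) = f 0 (unitFrac n, t)) (s t : I) (n : ℕ) :
    HR.liftProd f h₀ h₁ (alpha (s, n), t) = f n (s, t) := rfl

/-! ### Tent functions and points of the ropes -/

/-- The tent function with value `1` at `1 / n` and `0` outside of a small neighborhood. -/
noncomputable def tent (n : ℕ) : C(I, I) :=
  ⟨fun u => ⟨max 0 (1 - |(u : ℝ) - 1 / n| * (n * (n + 1))), le_max_left _ _,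
    max_le zero_le_one (by have : 0 ≤ |(u : ℝ) - 1 / n| * (n * (n + 1)) := by positivity
                           linarith)⟩, by fun_prop⟩

theorem coe_tent (n : ℕ) (u : I) :
    (tent n u : ℝ) = max 0 (1 - |(u : ℝ) - 1 / n| * (n * (n + 1))) := rfl

theorem tent_eq_zero_of_le {n : ℕ} (hn : 1 ≤ n) {u : I} (hu : (u : ℝ) ≤ 1 / (n + 1 : ℕ)) :
    tent n u = 0 := by
  have hn' : (1 : ℝ) ≤ n := by exact_mod_cast hn
  ext
  rw [coe_tent, Set.Icc.coe_zero]
  apply max_eq_left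
  have h1 : 1 / (n : ℝ) - 1 / (n + 1 : ℕ) = 1 / (n * (n + 1)) := by
    push_cast; field_simp; ring
  have h2 : 1 / ((n : ℝ) * (n + 1)) ≤ |(u : ℝ) - 1 / n| := by
    rw [abs_sub_comm]; exact le_trans (by linarith) (le_abs_self _)
  rw [div_le_iff₀ (by positivity)] at h2
  linarith

theorem tent_eq_zero_of_ge {n k : ℕ} (hk : 1 ≤ k) (hkn : k < n) {u : I}
    (hu : 1 / (k : ℝ) ≤ u) : tent n u = 0 := by
  have hk' : (1 : ℝ) ≤ k := by exact_mod_cast hk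
  have hn' : (k : ℝ) + 1 ≤ n := by exact_mod_cast hkn
  ext
  rw [coe_tent, Set.Icc.coe_zero]
  apply max_eq_left
  have h1 : 1 / ((n : ℝ) * (n + 1)) ≤ 1 / k - 1 / n := by
    rw [div_sub_div _ _ (by positivity) (by linarith),
      div_le_div_iff₀ (by nlinarith) (by nlinarith)]
    have : (1 : ℝ) ≤ 1 * n - k * 1 := by linarith
    have h0 : 0 ≤ (n : ℝ) * (n + 1) := by nlinarith
    nlinarith
  have h2 : 1 / ((n : ℝ) * (n + 1)) ≤ |(u : ℝ) - 1 / n| :=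
    le_trans (by linarith) (le_abs_self _)
  rw [div_le_iff₀ (by nlinarith)] at h2
  linarith

theorem tent_zero {n : ℕ} (hn : 1 ≤ n) : tent n 0 = 0 :=
  tent_eq_zero_of_le hn (by simp; positivity)

theorem tent_unitFrac_self (n : ℕ) : tent n (unitFrac n) = 1 := by
  ext; simp [coe_tent, coe_unitFrac]

theorem tent_unitFrac_of_ne {n m : ℕ} (hn : 1 ≤ n) (hm : 1 ≤ m) (h : m ≠ n) :
    tent n (unitFrac m) = 0 := by
  rcases lt_or_gt_of_ne h with h | h
  · exact tent_eq_zero_of_ge hm h le_rfl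
  · refine tent_eq_zero_of_le hn ?_
    rw [coe_unitFrac]
    gcongr
    exact h

theorem mem_A_iff {x : HR} : x ∈ A ↔ ∃ n ≥ 1, ∃ s, x = alpha (s, n) := by
  simp only [A, Set.mem_iUnion, Set.mem_image, Set.mem_prod, Set.mem_univ, true_and,
    Set.mem_singleton_iff, Prod.exists, exists_prop]
  constructor
  · rintro ⟨n, hn, s, _, rfl, rfl⟩; exact ⟨_, hn, s, rfl⟩
  · rintro ⟨n, hn, s, rfl⟩; exact ⟨n, hn, s, n, rfl, rfl⟩

theorem alpha_mem_A {n : ℕ} (hn : 1 ≤ n) (s : I) : alpha (s, n) ∈ A := mem_A_iff.2 ⟨n, hn, s, rfl⟩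

theorem unitFrac_mem_A {n : ℕ} (hn : 1 ≤ n) : alpha (unitFrac n, 0) ∈ A :=
  alpha_one hn ▸ alpha_mem_A hn 1

theorem zero_mem_A : alpha (0, 0) ∈ A := alpha_zero 1 ▸ alpha_mem_A le_rfl 0

theorem q_mem_A' {x : HR} (hx : x ∈ A) : q (x, 1) ∈ A' := ⟨(x, 1), ⟨hx, rfl⟩, rfl⟩

theorem q_surjective : Function.Surjective q := collapseMap_surjective _

/-- The map induced on the cone by a map which is constant on the base `HR × {0}`. -/
def X.lift {Z : Type*} [TopologicalSpace Z] (f : C(HR × I, Z)) (h : ∀ x y, f (x, 0) = f (y, 0)) :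
    C(X, Z) :=
  Collapse.lift f (by
    rintro ⟨x, t⟩ ⟨-, rfl⟩ ⟨y, s⟩ ⟨-, rfl⟩
    exact h x y)

@[simp]
theorem X.lift_q {Z : Type*} [TopologicalSpace Z] (f : C(HR × I, Z))
    (h : ∀ x y, f (x, 0) = f (y, 0)) (p : HR × I) : X.lift f h (q p) = f p := rfl

/-- The map induced on `X / A'` by a map on `HR × I`. -/
def quotLift {Z : Type*} [TopologicalSpace Z] (f : C(HR × I, Z)) (h : ∀ x y, f (x, 0) = f (y, 0))
    (h' : ∀ x ∈ A, ∀ y ∈ A, f (x, 1) = f (y, 1)) : C(Collapse A', Z) :=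
  Collapse.lift (X.lift f h) (by
    rintro _ ⟨⟨x, t⟩, ⟨hx, rfl⟩, rfl⟩ _ ⟨⟨y, s⟩, ⟨hy, rfl⟩, rfl⟩
    exact h' x hx y hy)

/-! ### The winding functions and their zeros -/

/-- A function on the Hawaiian ropes which takes the value `n` at the midpoint of the
`n`-th rope. -/
noncomputable def height : C(HR, ℝ) :=
  HR.lift (fun n => ⟨fun s => n * (4 * s * (1 - s)), by fun_prop⟩) (by simp) (by simp)

theorem height_alpha (s : I) (n : ℕ) : height (alpha (s, n)) = n * (4 * s * (1 - s)) := rfl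

/-- A complex function on `HR × I` which winds around the origin along the base interval near
`1 / m`. Its only zero is at the center of the strip over the `m`-th rope. -/
noncomputable def windingProd (m : ℕ) (hm : 1 ≤ m) : C(HR × I, ℂ) :=
  HR.liftProd (fun n =>
      if n = 0 then
        ⟨fun p => Complex.exp (((p.2 : ℝ) * (tent m p.1 : ℝ) : ℝ) * (2 * Real.pi * Complex.I)),
          by fun_prop⟩
      else if n = m then
        ⟨fun p => (1 - (p.1 : ℝ) : ℝ) +
          (p.1 : ℝ) * Complex.exp (((p.2 : ℝ)) * (2 * Real.pi * Complex.I)),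
          by fun_prop⟩
      else 1)
    (by
      intro n hn t
      have : n ≠ 0 := by lia
      by_cases h : n = m
      · subst h; simp [this, tent_zero hm]
      · simp [this, h, tent_zero hm])
    (by
      intro n hn t
      have : n ≠ 0 := by lia
      by_cases h : n = m
      · subst h; simp [this, tent_unitFrac_self]
      · simp [this, h, tent_unitFrac_of_ne hm hn h])

section

variable {m : ℕ} (hm : 1 ≤ m)

theorem windingProd_base (u t : I) : windingProd m hm (alpha (u, 0), t) =
    Complex.exp (((t : ℝ) * (tent m u : ℝ) : ℝ) * (2 * Real.pi * Complex.I)) := rfl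

theorem windingProd_rope (s t : I) : windingProd m hm (alpha (s, m), t) =
    (1 - (s : ℝ) : ℝ) + (s : ℝ) * Complex.exp (((t : ℝ)) * (2 * Real.pi * Complex.I)) := by
  have : m ≠ 0 := by lia
  simp [windingProd, this]

theorem windingProd_of_ne {n : ℕ} (hn : n ≠ 0) (h : n ≠ m) (s t : I) :
    windingProd m hm (alpha (s, n), t) = 1 := by
  simp [windingProd, hn, h]

theorem windingProd_zero (x : HR) : windingProd m hm (x, 0) = 1 := by
  obtain ⟨⟨s, n⟩, rfl⟩ := alpha_surjective x
  rcases eq_or_ne n 0 with rfl | hn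
  · simp [windingProd_base]
  rcases eq_or_ne n m with rfl | h
  · simp [windingProd_rope]
  · exact windingProd_of_ne hm hn h _ _

theorem windingProd_one {x : HR} (hx : x ∈ A) : windingProd m hm (x, 1) = 1 := by
  obtain ⟨n, hn, s, rfl⟩ := mem_A_iff.1 hx
  rcases eq_or_ne n m with rfl | h
  · simp [windingProd_rope]
  · exact windingProd_of_ne hm (by lia) h _ _

/-- The function on `X / A'` induced by `windingProd`. -/
noncomputable def winding (m : ℕ) (hm : 1 ≤ m) : C(Collapse A', ℂ) :=
  quotLift (windingProd m hm) (fun x y => by simp only [windingProd_zero])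
    (fun x hx y hy => by rw [windingProd_one hm hx, windingProd_one hm hy])

/-- A function on `X / A'` which is large at the zeros of the functions `winding`. -/
noncomputable def detect : C(Collapse A', ℝ) :=
  quotLift ⟨fun p => height p.1 * ‖1 - Complex.exp ((p.2 : ℝ) * (2 * Real.pi * Complex.I))‖,
    by fun_prop⟩ (by simp) (by simp)

/-- A zero of `(1 - s) + s * z` with `‖z‖ = 1` forces `s = 1/2` and `z = -1`. There the height is
`m` and `‖1 - z‖ = 2`. -/
theorem detect_of_winding_eq_zero {y : Collapse A'} (h : winding m hm y = 0) :
    detect y = 2 * m := by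
  obtain ⟨x, rfl⟩ := collapseMap_surjective _ y
  obtain ⟨⟨x, t⟩, rfl⟩ := q_surjective x
  change windingProd m hm (x, t) = 0 at h
  change height x * ‖1 - Complex.exp ((t : ℝ) * (2 * Real.pi * Complex.I))‖ = _
  obtain ⟨⟨s, n⟩, rfl⟩ := alpha_surjective x
  revert h
  rcases eq_or_ne n 0 with rfl | hn
  · intro h
    exact absurd h (Complex.exp_ne_zero _)
  rcases eq_or_ne n m with rfl | hnm
  · rw [windingProd_rope, height_alpha]
    intro h
    set z := Complex.exp ((t : ℝ) * (2 * Real.pi * Complex.I)) with hz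
    have hz1 : ‖z‖ = 1 := by
      rw [hz, show ((t : ℝ) : ℂ) * (2 * Real.pi * Complex.I) =
        (((t : ℝ) * (2 * Real.pi) : ℝ) : ℂ) * Complex.I by
        push_cast; ring]
      exact Complex.norm_exp_ofReal_mul_I _
    have h1 : ((1 - (s : ℝ) : ℝ) : ℂ) = -((s : ℝ) * z) := eq_neg_of_add_eq_zero_left h
    have h2 := congrArg norm h1
    rw [norm_neg, norm_mul, hz1, Complex.norm_real, Complex.norm_real, Real.norm_of_nonneg s.2.1,
      Real.norm_of_nonneg (by linarith [s.2.2]), mul_one] at h2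
    have h3 : (s : ℝ) = 1 / 2 := by linarith
    rw [h3] at h ⊢
    have h4 : z = -1 := by
      push_cast at h
      linear_combination 2 * h
    rw [h4]
    norm_num
    ring
  · rw [windingProd_of_ne hm hn hnm]
    simp

end

/-- The sequence of functions `winding m`, where `m ≥ 2` is even. -/
noncomputable def windingSeq (k : ℕ) : C(Collapse A', ℂ) := winding (2 * k + 2) (by lia)

theorem windingSeq_ne_zero (K : Set (Collapse A')) (hK : IsCompact K) :
    ∀ᶠ k in atTop, ∀ y ∈ K, windingSeq k y ≠ 0 := by
  obtain ⟨B, hB⟩ := (hK.image detect.continuous).bddAbove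
  filter_upwards [tendsto_natCast_atTop_atTop.eventually_gt_atTop B] with k hk y hy h
  have h1 := hB ⟨y, hy, rfl⟩
  rw [detect_of_winding_eq_zero _ h] at h1
  push_cast at h1
  have : (0 : ℝ) ≤ k := by positivity
  linarith

/-! ### Loops through selected gaps of the base interval -/

/-- The inclusion of the base interval of the Hawaiian ropes into `X / A'`. -/
def baseMap : C(I, Collapse A') :=
  (collapseMap A').comp (q.comp ⟨fun u => (alpha (u, 0), 1), by fun_prop⟩)

theorem baseMap_unitFrac {n : ℕ} (hn : 1 ≤ n) : baseMap (unitFrac n) = baseMap 0 :=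
  collapseMap_eq (q_mem_A' (unitFrac_mem_A hn)) (q_mem_A' zero_mem_A)

theorem winding_baseMap {m : ℕ} (hm : 1 ≤ m) (u : I) : winding m hm (baseMap u) =
    Complex.exp ((tent m u : ℝ) * (2 * Real.pi * Complex.I)) := by
  change windingProd m hm (alpha (u, 0), 1) = _
  simp [windingProd_base]

/-- The union of the gaps `(1 / (2k + 3), 1 / (2k + 2))` selected by a binary sequence. -/
def gaps (b : ℕ → Bool) : Set I :=
  {u | ∃ k, b k = true ∧ 1 / ((2 * k + 2 + 1 : ℕ) : ℝ) < u ∧ (u : ℝ) < 1 / (2 * k + 2 : ℕ)}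

theorem isOpen_gaps (b : ℕ → Bool) : IsOpen (gaps b) := by
  have : gaps b = ⋃ k, {u : I | b k = true ∧ 1 / ((2 * k + 2 + 1 : ℕ) : ℝ) < u ∧
      (u : ℝ) < 1 / (2 * k + 2 : ℕ)} := by
    ext; simp [gaps]
  rw [this]
  refine isOpen_iUnion fun k => ?_
  exact isOpen_const.inter (isOpen_Ioo.preimage continuous_subtype_val)

theorem exists_gap {u : I} (h0 : u ≠ 0) (hu : ∀ n ≥ 1, u ≠ unitFrac n) :
    ∃ n : ℕ, 1 ≤ n ∧ 1 / ((n + 1 : ℕ) : ℝ) < u ∧ (u : ℝ) < 1 / n := by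
  have hpos : 0 < (u : ℝ) := lt_of_le_of_ne u.2.1 fun h => h0 (Subtype.ext h.symm)
  have h1 : 1 ≤ 1 / (u : ℝ) := by rw [le_div_iff₀ hpos]; linarith [u.2.2]
  have hn : 1 ≤ ⌊1 / (u : ℝ)⌋₊ := Nat.one_le_floor_iff _ |>.2 h1
  refine ⟨⌊1 / (u : ℝ)⌋₊, hn, ?_, ?_⟩
  · rw [div_lt_comm₀ (by positivity) hpos]
    exact_mod_cast Nat.lt_floor_add_one (1 / (u : ℝ))
  · refine lt_of_le_of_ne ?_ fun h => hu _ hn (Subtype.ext h)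
    rw [le_div_comm₀ hpos (by exact_mod_cast hn)]
    exact Nat.floor_le (by positivity)

theorem gap_unique {u : ℝ} {n m : ℕ} (hn : 1 / ((n + 1 : ℕ) : ℝ) < u) (hn' : u < 1 / n)
    (hm : 1 / ((m + 1 : ℕ) : ℝ) < u) (hm' : u < 1 / m) : n = m := by
  have key {n m : ℕ} (hn' : u < 1 / n) (hm : 1 / ((m + 1 : ℕ) : ℝ) < u) : n ≤ m := by
    by_contra! h
    have : 1 / (n : ℝ) ≤ 1 / ((m + 1 : ℕ) : ℝ) := by
      gcongr
      exact h
    linarith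
  exact le_antisymm (key hn' hm) (key hm' hn)

open Classical in
/-- The loop in `X / A'` which runs through the gaps of the base interval selected by a binary
sequence. -/
noncomputable def gapLoop (b : ℕ → Bool) : Path (baseMap 0) (baseMap 0) where
  toFun u := if u ∈ gaps b then baseMap u else baseMap 0
  continuous_toFun := by
    rw [continuous_iff_continuousAt]
    intro u
    by_cases hu : u ∈ gaps b
    · refine baseMap.continuous.continuousAt.congr ?_
      filter_upwards [(isOpen_gaps b).mem_nhds hu] with v hv
      rw [if_pos hv]
    -- Outside the selected gaps there are two cases: either `u` is mapped to the base point, and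
    -- both branches tend to it, or `u` lies in an unselected gap, where the loop is locally
    -- constant.
    by_cases hb : baseMap u = baseMap 0
    · rw [ContinuousAt, if_neg hu]
      refine Tendsto.if' ?_ tendsto_const_nhds
      rw [← hb]
      exact baseMap.continuous.continuousAt
    · obtain ⟨n, hn, h1, h2⟩ := exists_gap (u := u) (by rintro rfl; exact hb rfl)
        (by rintro n hn rfl; exact hb (baseMap_unitFrac hn))
      refine continuousAt_const.congr (f := fun _ => baseMap 0) ?_
      have ho : IsOpen {v : I | 1 / ((n + 1 : ℕ) : ℝ) < v ∧ (v : ℝ) < 1 / n} :=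
        isOpen_Ioo.preimage continuous_subtype_val
      filter_upwards [ho.mem_nhds ⟨h1, h2⟩] with v hv
      rw [if_neg]
      rintro ⟨k, hk, h3, h4⟩
      obtain rfl := gap_unique hv.1 hv.2 h3 h4
      exact hu ⟨k, hk, h1, h2⟩
  source' := by simp
  target' := by
    rw [if_neg]
    rintro ⟨k, -, -, h⟩
    rw [Set.Icc.coe_one, lt_div_iff₀ (by positivity)] at h
    push_cast at h
    have : (0 : ℝ) ≤ k := by positivity
    linarith

/-- The ramp function which rises from `0` to `1` on the interval `[1 / (m + 1), 1 / m]`. -/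
noncomputable def ramp (m : ℕ) : C(I, ℝ) :=
  ⟨fun u => max 0 (min 1 (m * ((m + 1) * (u : ℝ) - 1))), by fun_prop⟩

theorem ramp_apply (m : ℕ) (u : I) : ramp m u = max 0 (min 1 (m * ((m + 1) * (u : ℝ) - 1))) := rfl

theorem ramp_of_le {m : ℕ} {u : I} (h : (u : ℝ) ≤ 1 / (m + 1 : ℕ)) : ramp m u = 0 := by
  rw [le_div_iff₀ (by positivity)] at h
  push_cast at h
  rw [ramp_apply]
  refine max_eq_left (min_le_of_right_le ?_)
  exact mul_nonpos_of_nonneg_of_nonpos (by positivity) (by linarith)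

theorem ramp_of_ge {m : ℕ} (hm : 1 ≤ m) {u : I} (h : 1 / (m : ℝ) ≤ u) : ramp m u = 1 := by
  have hm' : (1 : ℝ) ≤ m := by exact_mod_cast hm
  rw [div_le_iff₀ (by positivity)] at h
  rw [ramp_apply, min_eq_left, max_eq_right zero_le_one]
  nlinarith

theorem ramp_eq_tent {m : ℕ} {u : I} (h1 : 1 / ((m + 1 : ℕ) : ℝ) < u) (h2 : (u : ℝ) < 1 / m) :
    ramp m u = tent m u := by
  have hm' : (0 : ℝ) < m := by
    rcases Nat.eq_zero_or_pos m with rfl | h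
    · have := u.2.1
      simp at h2; linarith
    · exact_mod_cast h
  rw [ramp_apply, coe_tent, abs_of_neg (by linarith)]
  have e : 1 - -((u : ℝ) - 1 / m) * (m * (m + 1)) = m * ((m + 1) * u - 1) := by
    field_simp; ring
  rw [e, min_eq_right]
  rw [lt_div_iff₀ (by positivity)] at h2
  nlinarith

-- Passing from `tent` to `ramp` yields a continuous logarithm: the tent climbs to `1` along the gap
-- below `1/(2k+2)` and then drops to `0` when the loop leaves this gap, whereas the ramp stays at
-- `1`, which has the same exponential.
open Classical in
theorem winding_gapLoop (b : ℕ → Bool) (k : ℕ) (u : I) : windingSeq k (gapLoop b u) =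
    Complex.exp ((if b k then ramp (2 * k + 2) u else 0 : ℝ) * (2 * Real.pi * Complex.I)) := by
  change winding (2 * k + 2) _ (if u ∈ gaps b then baseMap u else baseMap 0) = _
  have hone : Complex.exp (2 * Real.pi * Complex.I) = 1 := Complex.exp_two_pi_mul_I
  by_cases hu : u ∈ gaps b
  · rw [if_pos hu, winding_baseMap]
    obtain ⟨j, hj, h1, h2⟩ := hu
    -- Only gaps below even denominators are ever selected, so the gap just above `1/(2k+2)`, where
    -- the tent would descend and cancel the winding, is never traversed.
    rcases lt_trichotomy j k with hjk | rfl | hjk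
    · have h3 : 1 / ((2 * j + 2 + 1 : ℕ) : ℝ) ≤ u := h1.le
      rw [tent_eq_zero_of_ge (k := 2 * j + 3) (by lia) (by lia) h3, ramp_of_ge (by lia)]
      · split_ifs <;> simp [hone]
      · exact (one_div_le_one_div_of_le (by positivity) (Nat.cast_le.2 (by lia))).trans h3
    · rw [if_pos hj, ramp_eq_tent h1 h2]
    · have h3 : (u : ℝ) ≤ 1 / ((2 * k + 2 + 1 : ℕ) : ℝ) :=
         h2.le.trans (one_div_le_one_div_of_le (by positivity) (Nat.cast_le.2 (by lia)))
      rw [tent_eq_zero_of_le (by lia) h3, ramp_of_le h3]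
      simp
  · rw [if_neg hu, winding_baseMap, tent_zero (by lia)]
    split_ifs with hb
    · rcases le_or_gt (u : ℝ) (1 / ((2 * k + 2 + 1 : ℕ) : ℝ)) with h | h
      · rw [ramp_of_le h]; simp
      · rcases lt_or_ge (u : ℝ) (1 / ((2 * k + 2 : ℕ) : ℝ)) with h' | h'
        · exact absurd ⟨k, hb, h, h'⟩ hu
        · rw [ramp_of_ge (by lia) h']; simp [hone]
    · simp

theorem logIncrement_gapLoop (b : ℕ → Bool) (k : ℕ) :
    logIncrement ((windingSeq k).comp (gapLoop b).toContinuousMap) =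
      if b k then 2 * Real.pi * Complex.I else 0 := by
  rw [logIncrement_eq ⟨fun u =>
    (if b k then ramp (2 * k + 2) u else 0 : ℝ) * (2 * Real.pi * Complex.I), by
      split_ifs <;> fun_prop⟩ fun u => (winding_gapLoop b k u).symm]
  have h1 : ramp (2 * k + 2) 1 = 1 := by
    refine ramp_of_ge (by lia) ?_
    rw [Set.Icc.coe_one, div_le_one (by positivity)]
    norm_cast
    lia
  have h0 : ramp (2 * k + 2) 0 = 0 := ramp_of_le (by rw [Set.Icc.coe_zero]; positivity)
  simp only [ContinuousMap.coe_mk, h1, h0]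
  split_ifs <;> simp

/-- Germs ignore finitely many indices, so each bit `a i` is placed at all the indices `Nat.pair i
N`; one of them lies beyond any bound. -/
theorem logGerm_gapLoop_injective : Function.Injective fun a : ℕ → Bool =>
    logGerm windingSeq (gapLoop fun k => a k.unpair.1).toContinuousMap := by
  intro a a' h
  have h' := Germ.coe_eq.1 h
  obtain ⟨N, hN⟩ := eventually_atTop.1 h'
  ext i
  have := hN (Nat.pair i N) (Nat.right_le_pair i N)
  simp only [logIncrement_gapLoop, Nat.unpair_pair] at this
  have h2 := Complex.two_pi_I_ne_zero
  cases h : a i <;> cases h' : a' i <;> simp_all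

instance : Uncountable (ℕ → Bool) :=
  Cardinal.aleph0_lt_mk_iff.1 (by simpa using Cardinal.cantor Cardinal.aleph0)

theorem uncountable_H1_collapse : Uncountable (H1 (Collapse A')) :=
  uncountable_H1 windingSeq_ne_zero (fun a : ℕ → Bool => gapLoop fun k => a k.unpair.1)
    logGerm_gapLoop_injective

theorem uncountable_fundamentalGroup_collapse [PathConnectedSpace (Collapse A')]
    (y : Collapse A') : Uncountable (FundamentalGroup (Collapse A') y) := by
  have := uncountable_fundamentalGroup windingSeq_ne_zero
    (fun a : ℕ → Bool => gapLoop fun k => a k.unpair.1) logGerm_gapLoop_injective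
  exact (FundamentalGroup.fundamentalGroupMulEquivOfPathConnected (baseMap 0)
    y).toEquiv.injective.uncountable

/-! ### Coordinate functions and separation properties of the Hawaiian ropes -/

/-- A map of the unit interval which collapses neighborhoods of the endpoints. -/
noncomputable def stretch : C(I, I) :=
  ⟨fun s => Set.projIcc 0 1 zero_le_one (3 * (s : ℝ) - 1), by fun_prop⟩

theorem stretch_of_le {s : I} (h : (s : ℝ) ≤ 1 / 3) : stretch s = 0 :=
  Set.projIcc_of_le_left zero_le_one (by linarith)

theorem stretch_of_ge {s : I} (h : 2 / 3 ≤ (s : ℝ)) : stretch s = 1 :=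
  Set.projIcc_of_right_le zero_le_one (by linarith)

theorem stretch_zero : stretch 0 = 0 := stretch_of_le (by simp)

theorem stretch_one : stretch 1 = 1 := stretch_of_ge (by norm_num)

/-- The retraction of the Hawaiian ropes to the base interval. -/
noncomputable def pos : C(HR, I) :=
  HR.lift (fun n => if n = 0 then .id I else ⟨fun s => stretch s * unitFrac n, by fun_prop⟩)
    (by
      intro n hn
      have : n ≠ 0 := by lia
      simp [this, stretch_zero])
    (by
      intro n hn
      have : n ≠ 0 := by lia
      simp [this, stretch_one])

theorem pos_base (u : I) : pos (alpha (u, 0)) = u := rfl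

theorem pos_rope {n : ℕ} (hn : 1 ≤ n) (s : I) : pos (alpha (s, n)) = stretch s * unitFrac n := by
  have : n ≠ 0 := by lia
  simp [pos, this]

/-- The coordinate along the `m`-th rope, extended by `tent m` to the base interval. -/
noncomputable def ropeCoord (m : ℕ) (hm : 1 ≤ m) : C(HR, I) :=
  HR.lift (fun n => if n = 0 then tent m else if n = m then .id I else .const I 0)
    (by
      intro n hn
      have : n ≠ 0 := by lia
      by_cases h : n = m
      · subst h; simp [this, tent_zero hm]
      · simp [this, h, tent_zero hm])
    (by
      intro n hn
      have : n ≠ 0 := by lia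
      by_cases h : n = m
      · subst h; simp [this, tent_unitFrac_self]
      · simp [this, h, tent_unitFrac_of_ne hm hn h])

theorem ropeCoord_rope {m : ℕ} (hm : 1 ≤ m) (s : I) : ropeCoord m hm (alpha (s, m)) = s := by
  have : m ≠ 0 := by lia
  simp [ropeCoord, this]

theorem ropeCoord_of_ne {m n : ℕ} (hm : 1 ≤ m) (hn : 1 ≤ n) (h : n ≠ m) (s : I) :
    ropeCoord m hm (alpha (s, n)) = 0 := by
  have : n ≠ 0 := by lia
  simp [ropeCoord, h, this]

/-- The function `c n * s * (1 - s)` on the ropes, extended by `0` to the base interval. -/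
noncomputable def ropeBump (c : ℕ → ℝ) : C(HR, ℝ) :=
  HR.lift (fun n => if n = 0 then 0 else ⟨fun s => c n * (s * (1 - s)), by fun_prop⟩)
    (by
      intro n hn
      have : n ≠ 0 := by lia
      simp [this])
    (by
      intro n hn
      have : n ≠ 0 := by lia
      simp [this])

theorem ropeBump_base (c : ℕ → ℝ) (u : I) : ropeBump c (alpha (u, 0)) = 0 := rfl

theorem ropeBump_rope (c : ℕ → ℝ) {n : ℕ} (hn : 1 ≤ n) (s : I) :
    ropeBump c (alpha (s, n)) = c n * (s * (1 - s)) := by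
  have : n ≠ 0 := by lia
  simp [ropeBump, this]

theorem base_or_rope (x : HR) : (∃ u, x = alpha (u, 0)) ∨
    ∃ n ≥ 1, ∃ s : I, 0 < (s : ℝ) ∧ (s : ℝ) < 1 ∧ x = alpha (s, n) := by
  obtain ⟨⟨s, n⟩, rfl⟩ := alpha_surjective x
  rcases Nat.eq_zero_or_pos n with rfl | hn
  · exact .inl ⟨s, rfl⟩
  rcases eq_or_ne s 0 with rfl | h0
  · exact .inl ⟨0, alpha_zero n⟩
  rcases eq_or_ne s 1 with rfl | h1
  · exact .inl ⟨_, alpha_one hn⟩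
  · exact .inr ⟨n, hn, s, unitInterval.pos_iff_ne_zero.2 h0,
      unitInterval.lt_one_iff_ne_one.2 h1, rfl⟩

theorem alpha_base_ne {u s : I} {n : ℕ} (hn : 1 ≤ n) (h0 : 0 < (s : ℝ)) (h1 : (s : ℝ) < 1) :
    alpha (u, 0) ≠ alpha (s, n) := by
  intro h
  have := congrArg (ropeBump fun _ => 1) h
  rw [ropeBump_base, ropeBump_rope _ hn, one_mul] at this
  have : 0 < (s : ℝ) * (1 - s) := mul_pos h0 (by linarith)
  linarith

instance : T2Space HR := by
  let f : HR → I × (ℕ → ℝ) × (ℕ → I) := fun x =>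
    (pos x, fun n => ropeBump (Pi.single n 1) x, fun n => ropeCoord (n + 1) (by lia) x)
  have hf : Continuous f := by fun_prop
  refine T2Space.of_injective_continuous (f := f) ?_ hf
  intro x y hxy
  simp only [f, Prod.mk.injEq] at hxy
  obtain ⟨h1, h2, h3⟩ := hxy
  have key (u s : I) (n : ℕ) (hn : 1 ≤ n) (hs0 : 0 < (s : ℝ)) (hs1 : (s : ℝ) < 1) :
      ropeBump (Pi.single n 1) (alpha (u, 0)) ≠ ropeBump (Pi.single n 1) (alpha (s, n)) := by
    rw [ropeBump_base, ropeBump_rope _ hn, Pi.single_eq_same, one_mul]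
    exact (mul_pos hs0 (by linarith)).ne
  rcases base_or_rope x with ⟨u, rfl⟩ | ⟨n, hn, s, hs0, hs1, rfl⟩ <;>
  rcases base_or_rope y with ⟨v, rfl⟩ | ⟨m, hm, t, ht0, ht1, rfl⟩
  · rw [pos_base, pos_base] at h1
    rw [h1]
  · exact absurd (congrFun h2 m) (key u t m hm ht0 ht1)
  · exact absurd (congrFun h2 n).symm (key v s n hn hs0 hs1)
  · have h4 := congrFun h2 n
    rw [ropeBump_rope _ hn, ropeBump_rope _ hm, Pi.single_eq_same] at h4
    obtain rfl : m = n := by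
      by_contra hne
      rw [Pi.single_eq_of_ne hne] at h4
      have : 0 < (s : ℝ) * (1 - s) := mul_pos hs0 (by linarith)
      linarith
    have h5 := congrFun h3 (m - 1)
    obtain ⟨k, rfl⟩ : ∃ k, m = k + 1 := ⟨m - 1, by lia⟩
    simp only [Nat.add_sub_cancel, ropeCoord_rope] at h5
    rw [h5]

/-- Tietze extension from `C ∪ D ∪ {0, 1}`. The prescribed end values allow separating functions on
the ropes to be glued to one already chosen on the base interval. -/
theorem exists_extension_separating {C D : Set I} (hC : IsClosed C) (hD : IsClosed D)
    (hCD : Disjoint C D) (v w : ℝ) (hv0 : 0 ∈ C → v = 0) (hv1 : 0 ∈ D → v = 1)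
    (hw0 : 1 ∈ C → w = 0) (hw1 : 1 ∈ D → w = 1) :
    ∃ f : C(I, ℝ), f 0 = v ∧ f 1 = w ∧ (∀ x ∈ C, f x = 0) ∧ ∀ x ∈ D, f x = 1 := by
  classical
  let g : I → ℝ := fun x => if x ∈ C then 0 else if x ∈ D then 1 else if x = 0 then v else w
  have hgC : ∀ x ∈ C, g x = 0 := fun x hx => if_pos hx
  have hgD : ∀ x ∈ D, g x = 1 := fun x hx => by
    simp [g, hx, hCD.notMem_of_mem_right hx]
  have hg0 : g 0 = v := by
    by_cases h : 0 ∈ C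
    · rw [hgC 0 h, hv0 h]
    by_cases h' : 0 ∈ D
    · rw [hgD 0 h', hv1 h']
    simp [g, h, h']
  have hg1 : g 1 = w := by
    by_cases h : 1 ∈ C
    · rw [hgC 1 h, hw0 h]
    by_cases h' : 1 ∈ D
    · rw [hgD 1 h', hw1 h']
    simp [g, h, h']
  have c1 : ContinuousOn g C := continuousOn_const.congr hgC
  have c2 : ContinuousOn g D := continuousOn_const.congr hgD
  have c3 : ContinuousOn g ((C ∪ D) ∪ ({0} ∪ {1})) :=
    (c1.union_of_isClosed c2 hC hD).union_of_isClosed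
      ((continuousOn_singleton g 0).union_of_isClosed (continuousOn_singleton g 1)
        isClosed_singleton isClosed_singleton) (hC.union hD)
      (isClosed_singleton.union isClosed_singleton)
  obtain ⟨f, hf⟩ := ContinuousMap.exists_restrict_eq
    ((hC.union hD).union (isClosed_singleton.union isClosed_singleton)) ⟨_, c3.domRestrict⟩
  have hf' : ∀ x ∈ ((C ∪ D) ∪ ({0} ∪ {1})), f x = g x := fun x hx =>
    DFunLike.congr_fun hf ⟨x, hx⟩
  refine ⟨f, ?_, ?_, fun x hx => ?_, fun x hx => ?_⟩
  · rw [hf' _ (by simp), hg0]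
  · rw [hf' _ (by simp), hg1]
  · rw [hf' _ (by simp [hx]), hgC x hx]
  · rw [hf' _ (by simp [hx]), hgD x hx]

instance : NormalSpace HR where
  normal C D hC hD hCD := by
    have slice {F : Set HR} (hF : IsClosed F) (n : ℕ) : IsClosed {s : I | alpha (s, n) ∈ F} :=
      hF.preimage (by fun_prop)
    have hdisj (n : ℕ) : Disjoint {s : I | alpha (s, n) ∈ C} {s : I | alpha (s, n) ∈ D} :=
      Set.disjoint_left.2 fun s h h' => Set.disjoint_left.1 hCD h h'
    obtain ⟨g, hgC, hgD, -⟩ := exists_continuous_zero_one_of_isClosed (slice hC 0) (slice hD 0)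
      (hdisj 0)
    have hg0 : ∀ u, alpha (u, 0) ∈ C → g u = 0 := fun u hu => hgC hu
    have hg1 : ∀ u, alpha (u, 0) ∈ D → g u = 1 := fun u hu => hgD hu
    have (n : ℕ) : ∃ f : C(I, ℝ), (1 ≤ n → f 0 = g 0) ∧ (1 ≤ n → f 1 = g (unitFrac n)) ∧
        (∀ s, alpha (s, n) ∈ C → f s = 0) ∧ (∀ s, alpha (s, n) ∈ D → f s = 1) ∧
        (n = 0 → f = g) := by
      rcases Nat.eq_zero_or_pos n with rfl | hn
      · exact ⟨g, by simp, by simp, hg0, hg1, fun _ => rfl⟩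
      · obtain ⟨f, h0, h1, h2, h3⟩ := exists_extension_separating (slice hC n) (slice hD n)
          (hdisj n) (g 0) (g (unitFrac n)) (fun h => hg0 _ (alpha_zero n ▸ h))
          (fun h => hg1 _ (alpha_zero n ▸ h)) (fun h => hg0 _ (alpha_one hn ▸ h))
          (fun h => hg1 _ (alpha_one hn ▸ h))
        exact ⟨f, fun _ => h0, fun _ => h1, h2, h3, fun h => absurd h (by lia)⟩
    choose f h0 h1 h2 h3 h4 using this
    let F : C(HR, ℝ) := HR.lift f (fun n hn => by rw [h0 n hn, h4 0 rfl])
      (fun n hn => by rw [h1 n hn, h4 0 rfl])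
    refine ⟨F ⁻¹' Set.Iio (1 / 2), F ⁻¹' Set.Ioi (1 / 2), isOpen_Iio.preimage F.continuous,
      isOpen_Ioi.preimage F.continuous, fun x hx => ?_, fun x hx => ?_, ?_⟩
    · obtain ⟨⟨s, n⟩, rfl⟩ := alpha_surjective x
      change f n s < 1 / 2
      rw [h2 n s hx]; norm_num
    · obtain ⟨⟨s, n⟩, rfl⟩ := alpha_surjective x
      change 1 / 2 < f n s
      rw [h3 n s hx]; norm_num
    · exact Set.disjoint_left.2 fun x (hx : F x < 1 / 2) (hx' : 1 / 2 < F x) =>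
        lt_asymm hx hx'

/-- Serves the normality of `HR × I`: a regular σ-compact space is Lindelöf, hence normal. -/
instance : SigmaCompactSpace HR := by
  rw [← isSigmaCompact_univ_iff, ← alpha_surjective.range_eq]
  exact isSigmaCompact_range alpha.continuous

/-! ### Collapsing closed sets; separation and closedness in the cone -/

theorem collapseMap_eq_iff {Y : Type*} [TopologicalSpace Y] {S : Set Y} {x y : Y} :
    collapseMap S x = collapseMap S y ↔ x = y ∨ (x ∈ S ∧ y ∈ S) := by
  refine ⟨fun h => ?_, ?_⟩
  · have : Relation.EqvGen _ x y := Quot.eqvGen_exact h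
    clear h
    induction this with
    | rel _ _ h => exact .inr h
    | refl _ => exact .inl rfl
    | symm _ _ _ ih => grind
    | trans _ _ _ _ _ ih ih' => grind
  · rintro (rfl | h)
    · rfl
    · exact collapseMap_eq h.1 h.2

theorem isQuotientMap_collapseMap {Y : Type*} [TopologicalSpace Y] (S : Set Y) :
    Topology.IsQuotientMap (collapseMap S) := isQuotientMap_quot_mk

/-- The saturation of a closed set `C` is either `C` or `C ∪ S`. -/
theorem isClosedMap_collapseMap {Y : Type*} [TopologicalSpace Y] {S : Set Y} (hS : IsClosed S) :
    IsClosedMap (collapseMap S) := by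
  intro C hC
  rw [← (isQuotientMap_collapseMap S).isClosed_preimage]
  by_cases h : (C ∩ S).Nonempty
  · obtain ⟨c, hc, hcS⟩ := h
    have : collapseMap S ⁻¹' (collapseMap S '' C) = C ∪ S := by
      ext y
      constructor
      · rintro ⟨x, hx, hxy⟩
        rcases collapseMap_eq_iff.1 hxy with rfl | h
        · exact .inl hx
        · exact .inr h.2
      · rintro (hy | hy)
        · exact ⟨y, hy, rfl⟩
        · exact ⟨c, hc, collapseMap_eq hcS hy⟩
    rw [this]
    exact hC.union hS
  · have : collapseMap S ⁻¹' (collapseMap S '' C) = C := by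
      refine (Set.subset_preimage_image _ _).antisymm' ?_
      rintro y ⟨x, hx, hxy⟩
      rcases collapseMap_eq_iff.1 hxy with rfl | h'
      · exact hx
      · exact absurd ⟨x, hx, h'.1⟩ h
    rwa [this]

theorem isOpenEmbedding_collapseMap {Y : Type*} [TopologicalSpace Y] {S : Set Y}
    {W : Set Y} (hW : IsOpen W) (h : Disjoint W S) :
    Topology.IsOpenEmbedding fun w : W => collapseMap S w := by
  refine .of_continuous_injective_isOpenMap (by fun_prop) ?_ ?_
  · rintro ⟨x, hx⟩ ⟨y, hy⟩ hxy
    rcases collapseMap_eq_iff.1 hxy with h' | h'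
    · exact Subtype.ext h'
    · exact absurd h'.1 (Set.disjoint_left.1 h hx)
  · intro U hU
    rw [← (isQuotientMap_collapseMap S).isOpen_preimage]
    convert! hW.isOpenMap_subtype_val U hU using 1
    ext y
    constructor
    · rintro ⟨x, hx, hxy⟩
      rcases collapseMap_eq_iff.1 hxy with h' | h'
      · exact ⟨x, hx, h'⟩
      · exact absurd h'.1 (Set.disjoint_left.1 h x.2)
    · rintro ⟨x, hx, rfl⟩
      exact ⟨x, hx, rfl⟩

theorem _root_.IsClosedMap.normalSpace {Y Z : Type*} [TopologicalSpace Y] [TopologicalSpace Z]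
    [NormalSpace Y] {f : Y → Z} (hf : IsClosedMap f) (hc : Continuous f)
    (hs : Function.Surjective f) : NormalSpace Z where
  normal C D hC hD hCD := by
    obtain ⟨U, V, hU, hV, hCU, hDV, hUV⟩ := normal_separation (hC.preimage hc) (hD.preimage hc)
      (hCD.preimage f)
    refine ⟨(f '' Uᶜ)ᶜ, (f '' Vᶜ)ᶜ, (hf _ hU.isClosed_compl).isOpen_compl,
      (hf _ hV.isClosed_compl).isOpen_compl, ?_, ?_, ?_⟩
    · rintro z hz ⟨y, hy, rfl⟩
      exact hy (hCU hz)
    · rintro z hz ⟨y, hy, rfl⟩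
      exact hy (hDV hz)
    · refine Set.disjoint_left.2 fun z hz hz' => ?_
      obtain ⟨y, rfl⟩ := hs z
      have h1 : y ∈ U := by_contra fun h => hz ⟨y, h, rfl⟩
      have h2 : y ∈ V := by_contra fun h => hz' ⟨y, h, rfl⟩
      exact Set.disjoint_left.1 hUV h1 h2

theorem isClosed_cone_base : IsClosed (Set.univ ×ˢ {0} : Set (HR × I)) :=
  isClosed_univ.prod isClosed_singleton

theorem isClosedMap_q : IsClosedMap q := isClosedMap_collapseMap isClosed_cone_base

instance : NormalSpace X := isClosedMap_q.normalSpace q.continuous q_surjective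

instance : T1Space X where
  t1 x := by
    obtain ⟨p, rfl⟩ := q_surjective x
    simpa using isClosedMap_q _ (isClosed_singleton (x := p))

theorem isClosed_A : IsClosed A := by
  have hq : Topology.IsQuotientMap alpha := isQuotientMap_quot_mk
  rw [← hq.isClosed_preimage]
  have key : ∀ n, IsClosed {s : I | alpha (s, n) ∈ A} := by
    intro n
    rcases Nat.eq_zero_or_pos n with rfl | hn
    -- The trace on the base interval is a convergent sequence with its limit, hence compact. The
    -- index `0` is harmless because `unitFrac 0 = 0`.
    · have : {s : I | alpha (s, 0) ∈ A} = insert 0 (Set.range unitFrac) := by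
        ext u
        constructor
        · intro hu
          obtain ⟨n, hn, s, hs⟩ := mem_A_iff.1 hu
          have h1 := congrArg pos hs
          rcases eq_or_ne s 0 with rfl | h0
          · rw [pos_base, pos_rope hn, stretch_zero, zero_mul] at h1
            exact .inl h1
          rcases eq_or_ne s 1 with rfl | h2
          · rw [pos_base, pos_rope hn, stretch_one, one_mul] at h1
            exact .inr ⟨n, h1.symm⟩
          · exact absurd hs (alpha_base_ne hn (unitInterval.pos_iff_ne_zero.2 h0)
              (unitInterval.lt_one_iff_ne_one.2 h2))
        · rintro (rfl | ⟨n, rfl⟩)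
          · exact zero_mem_A
          · rcases Nat.eq_zero_or_pos n with rfl | hn
            · rw [show unitFrac 0 = 0 from Subtype.ext (by simp [coe_unitFrac])]
              exact zero_mem_A
            · exact unitFrac_mem_A hn
      rw [this]
      have ht : Tendsto unitFrac atTop (𝓝 0) := by
        rw [tendsto_subtype_rng]
        exact tendsto_one_div_atTop_nhds_zero_nat
      exact ht.isCompact_insert_range.isClosed
    · convert! isClosed_univ
      ext s
      simp [alpha_mem_A hn s]
  rw [← isOpen_compl_iff]
  refine isOpen_prod_iff.2 ?_
  intro s n hs
  refine ⟨{s | alpha (s, n) ∈ A}ᶜ, {n}, (key n).isOpen_compl, isOpen_discrete _, hs, rfl, ?_⟩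
  rintro ⟨s', n'⟩ ⟨h, rfl⟩
  exact h

theorem isClosed_A' : IsClosed A' := isClosedMap_q _ (isClosed_A.prod isClosed_singleton)

/-- First countability fails at the common starting point of the ropes: given a countable
neighborhood basis, pick an interior point of rope `n + 1` in the `n`-th set. A bump function
rescaled to be `1` at all of these points is continuous, yet vanishes at their limit. -/
theorem not_metrizableSpace_X : ¬ TopologicalSpace.MetrizableSpace X := by
  intro hX
  obtain ⟨U, hU⟩ := (𝓝 (q (alpha (0, 0), 1))).exists_antitone_basis
  have (n : ℕ) : ∃ s : I, 0 < (s : ℝ) ∧ (s : ℝ) < 1 ∧ q (alpha (s, n + 1), 1) ∈ U n := by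
    have hc : Continuous fun s : I => q (alpha (s, n + 1), 1) := by fun_prop
    have h0 : (fun s : I => q (alpha (s, n + 1), 1)) ⁻¹' U n ∈ 𝓝 (0 : I) := by
      refine hc.continuousAt.preimage_mem_nhds ?_
      rw [alpha_zero]
      exact hU.1.mem_of_mem trivial
    obtain ⟨ε, hε, hs⟩ := Metric.mem_nhds_iff.1 h0
    have h1 : 0 < min (ε / 2) (1 / 2) := by positivity
    have h2 : min (ε / 2) (1 / 2) ≤ 1 / 2 := min_le_right _ _
    have h3 : min (ε / 2) (1 / 2) ≤ ε / 2 := min_le_left _ _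
    refine ⟨⟨min (ε / 2) (1 / 2), h1.le, by linarith⟩, h1, by simp only; linarith, hs ?_⟩
    rw [Metric.mem_ball, Subtype.dist_eq, Real.dist_eq, Set.Icc.coe_zero, sub_zero,
      abs_of_pos h1]
    linarith
  choose s hs0 hs1 hs using this
  let c : ℕ → ℝ := fun n => ((s (n - 1) : ℝ) * (1 - s (n - 1)))⁻¹
  let F : C(X, ℝ) := X.lift ⟨fun p => ropeBump c p.1 * p.2, by fun_prop⟩ (by simp)
  have h0 : F (q (alpha (0, 0), 1)) = 0 := by simp [F, ropeBump_base]
  have h1 (n : ℕ) : F (q (alpha (s n, n + 1), 1)) = 1 := by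
    have : (s n : ℝ) * (1 - s n) ≠ 0 := (mul_pos (hs0 n) (by linarith [hs1 n])).ne'
    simp only [F, X.lift_q, ContinuousMap.coe_mk, ropeBump_rope c (Nat.le_add_left 1 n), c,
      Nat.add_sub_cancel, inv_mul_cancel₀ this, Set.Icc.coe_one, mul_one]
  have h2 := (F.continuous.tendsto _).comp (hU.tendsto hs)
  simp only [Function.comp_def, h1, h0] at h2
  exact zero_ne_one (tendsto_nhds_unique h2 tendsto_const_nhds)

/-! ### Contractibility and local contractibility of the cone -/

theorem contractibleSpace_of_homotopies {Z : Type*} [TopologicalSpace Z] {O : Set Z}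
    (C₁ C₂ : C(Z × I, Z)) {z : Z} (hz : z ∈ O) (m₁ : ∀ x ∈ O, ∀ t, C₁ (x, t) ∈ O)
    (m₂ : ∀ x ∈ O, ∀ t, C₂ (x, t) ∈ O) (h₀ : ∀ x ∈ O, C₁ (x, 0) = x)
    (h₁ : ∀ x ∈ O, C₁ (x, 1) = C₂ (x, 0)) (h₂ : ∀ x ∈ O, C₂ (x, 1) = z) :
    ContractibleSpace O := by
  rw [contractible_iff_id_nullhomotopic]
  refine ⟨⟨z, hz⟩, ?_⟩
  let ρ : C(O, O) := ⟨fun x => ⟨C₁ (x, 1), m₁ x x.2 1⟩, by fun_prop⟩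
  have H₁ : (ContinuousMap.id O).Homotopic ρ :=
    ⟨{ toFun := fun p => ⟨C₁ (p.2, p.1), m₁ _ p.2.2 _⟩
       continuous_toFun := by fun_prop
       map_zero_left := fun x => Subtype.ext (h₀ x x.2)
       map_one_left := fun x => rfl }⟩
  have H₂ : ρ.Homotopic (.const O ⟨z, hz⟩) :=
    ⟨{ toFun := fun p => ⟨C₂ (p.2, p.1), m₂ _ p.2.2 _⟩
       continuous_toFun := by fun_prop
       map_zero_left := fun x => Subtype.ext (h₁ x x.2).symm
       map_one_left := fun x => Subtype.ext (h₂ x x.2) }⟩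
  exact H₁.trans H₂

theorem contractibleSpace_of_homotopy {Z : Type*} [TopologicalSpace Z] {O : Set Z}
    (C : C(Z × I, Z)) {z : Z} (hz : z ∈ O) (m : ∀ x ∈ O, ∀ t, C (x, t) ∈ O)
    (h₀ : ∀ x ∈ O, C (x, 0) = x) (h₁ : ∀ x ∈ O, C (x, 1) = z) : ContractibleSpace O :=
  contractibleSpace_of_homotopies C (.const _ z) hz m (fun _ _ _ => hz) h₀ h₁ fun _ _ => rfl

/-- The point at time `t` of the affine segment from `a` to `b` in the unit interval. -/
def seg (a b t : I) : I :=
  ⟨(1 - t) * a + t * b, (convex_Icc (0 : ℝ) 1) a.2 b.2 (by linarith [t.2.2]) t.2.1 (by ring)⟩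

theorem coe_seg (a b t : I) : (seg a b t : ℝ) = (1 - t) * a + t * b := rfl

@[fun_prop]
theorem continuous_seg {Z : Type*} [TopologicalSpace Z] {f g h : Z → I} (hf : Continuous f)
    (hg : Continuous g) (hh : Continuous h) : Continuous fun z => seg (f z) (g z) (h z) := by
  unfold seg
  fun_prop

@[simp]
theorem seg_zero (a b : I) : seg a b 0 = a := by ext; simp [coe_seg]

@[simp]
theorem seg_one (a b : I) : seg a b 1 = b := by ext; simp [coe_seg]

@[simp]
theorem seg_self (a t : I) : seg a a t = a := by ext; rw [coe_seg]; ring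

theorem dist_seg_le (a b t : I) : dist (seg a b t) b ≤ dist a b := by
  rw [Subtype.dist_eq, Subtype.dist_eq, Real.dist_eq, Real.dist_eq, coe_seg,
    show (1 - (t : ℝ)) * a + t * b - b = (1 - t) * (a - b) by ring, abs_mul,
    abs_of_nonneg (by linarith [t.2.2])]
  exact mul_le_of_le_one_left (abs_nonneg _) (by linarith [t.2.1])

theorem contractibleSpace_ball (u : I) {ε : ℝ} (hε : 0 < ε) :
    ContractibleSpace (Metric.ball u ε) :=
  contractibleSpace_of_homotopy ⟨fun p => seg p.1 u p.2, by fun_prop⟩ (Metric.mem_ball_self hε)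
    (fun x hx t => (dist_seg_le x u t).trans_lt hx) (by simp) (by simp)

theorem isOpen_HR_iff {O : Set HR} : IsOpen O ↔ ∀ n, IsOpen {s : I | alpha (s, n) ∈ O} := by
  have hq : Topology.IsQuotientMap alpha := isQuotientMap_quot_mk
  refine ⟨fun h n => h.preimage (by fun_prop), fun h => ?_⟩
  rw [← hq.isOpen_preimage, isOpen_prod_iff]
  intro s n hs
  refine ⟨_, {n}, h n, isOpen_discrete _, hs, rfl, ?_⟩
  rintro ⟨s', n'⟩ ⟨h, rfl⟩
  exact h

/-- The subset of the Hawaiian ropes with given traces on the base interval and on the ropes. -/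
def HR.mkSet (P : ℕ → Set I) (h₀ : ∀ n ≥ 1, 0 ∈ P n ↔ 0 ∈ P 0)
    (h₁ : ∀ n ≥ 1, 1 ∈ P n ↔ unitFrac n ∈ P 0) : Set HR :=
  {x | Quot.lift (fun p : I × ℕ => p.1 ∈ P p.2) (by
    rintro _ _ (⟨n, hn⟩ | ⟨n, hn, s, hs⟩)
    · exact propext (h₀ n hn)
    · obtain rfl : s = unitFrac n := Subtype.ext hs
      exact propext (h₁ n hn)) x}

theorem HR.alpha_mem_mkSet {P : ℕ → Set I} {h₀ : ∀ n ≥ 1, 0 ∈ P n ↔ 0 ∈ P 0}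
    {h₁ : ∀ n ≥ 1, 1 ∈ P n ↔ unitFrac n ∈ P 0} {s : I} {n : ℕ} :
    alpha (s, n) ∈ HR.mkSet P h₀ h₁ ↔ s ∈ P n := Iff.rfl

theorem HR.isOpen_mkSet {P : ℕ → Set I} {h₀ : ∀ n ≥ 1, 0 ∈ P n ↔ 0 ∈ P 0}
    {h₁ : ∀ n ≥ 1, 1 ∈ P n ↔ unitFrac n ∈ P 0} (h : ∀ n, IsOpen (P n)) :
    IsOpen (HR.mkSet P h₀ h₁) := isOpen_HR_iff.2 h

theorem exists_contractible_nhd_rope {V : Set HR} (hV : IsOpen V) {n : ℕ} (hn : 1 ≤ n) {s₀ : I}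
    (h0 : 0 < (s₀ : ℝ)) (h1 : (s₀ : ℝ) < 1) (hs : alpha (s₀, n) ∈ V) :
    ∃ O ⊆ V, IsOpen O ∧ alpha (s₀, n) ∈ O ∧ ContractibleSpace O := by
  obtain ⟨ε, hε, hball⟩ := Metric.isOpen_iff.1 (isOpen_HR_iff.1 hV n) s₀ hs
  obtain ⟨δ, hδ, hδε, hδ0, hδ1⟩ : ∃ δ > 0, δ ≤ ε ∧ δ ≤ s₀ ∧ δ ≤ 1 - s₀ :=
    ⟨min ε (min s₀ (1 - s₀)), by positivity [sub_pos.2 h1], min_le_left _ _,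
      (min_le_right _ _).trans (min_le_left _ _), (min_le_right _ _).trans (min_le_right _ _)⟩
  have hne : n ≠ 0 := by lia
  have e0 : (0 : I) ∉ Metric.ball s₀ δ := by
    rw [Metric.mem_ball, Subtype.dist_eq, Real.dist_eq, Set.Icc.coe_zero, zero_sub, abs_neg,
      abs_of_pos h0]
    linarith
  have e1 : (1 : I) ∉ Metric.ball s₀ δ := by
    rw [Metric.mem_ball, Subtype.dist_eq, Real.dist_eq, Set.Icc.coe_one,
      abs_of_pos (by linarith)]
    linarith
  let O : Set HR := HR.mkSet (fun k => {s | k = n ∧ s ∈ Metric.ball s₀ δ})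
    (fun k hk => iff_of_false (fun h => e0 h.2) (fun h => hne h.1.symm))
    (fun k hk => iff_of_false (fun h => e1 h.2) (fun h => hne h.1.symm))
  have hO {x : HR} (hx : x ∈ O) : ∃ s ∈ Metric.ball s₀ δ, x = alpha (s, n) := by
    obtain ⟨⟨s, k⟩, rfl⟩ := alpha_surjective x
    obtain ⟨rfl, hs'⟩ := HR.alpha_mem_mkSet.1 hx
    exact ⟨s, hs', rfl⟩
  have hO' {s : I} (hs : s ∈ Metric.ball s₀ δ) : alpha (s, n) ∈ O := ⟨rfl, hs⟩
  refine ⟨O, fun x hx => ?_, HR.isOpen_mkSet fun k => isOpen_const.inter Metric.isOpen_ball,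
    hO' (Metric.mem_ball_self hδ), ?_⟩
  · obtain ⟨s, hs, rfl⟩ := hO hx
    exact hball (Metric.ball_subset_ball hδε hs)
  · refine contractibleSpace_of_homotopy
      ⟨fun p => alpha (seg (ropeCoord n hn p.1) s₀ p.2, n), by fun_prop⟩
      (hO' (Metric.mem_ball_self hδ)) ?_ ?_ ?_
    · intro x hx t
      obtain ⟨s, hs, rfl⟩ := hO hx
      refine hO' ?_
      rw [ropeCoord_rope]
      exact (dist_seg_le _ _ _).trans_lt hs
    · intro x hx
      obtain ⟨s, hs, rfl⟩ := hO hx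
      simp [ropeCoord_rope]
    · intro x hx
      simp

/-- The deformation of the Hawaiian ropes which pulls the ends of the ropes to the base
interval. -/
noncomputable def pullEnds : C(HR × I, HR) :=
  HR.liftProd (fun n => if n = 0 then ⟨fun p => alpha (p.1, 0), by fun_prop⟩ else
      ⟨fun p => alpha (seg p.1 (stretch p.1) p.2, n), by fun_prop⟩)
    (by
      intro n hn t
      have : n ≠ 0 := by lia
      simp [this, stretch_zero, alpha_zero])
    (by
      intro n hn t
      have : n ≠ 0 := by lia
      simp [this, stretch_one, alpha_one hn])

theorem pullEnds_rope {n : ℕ} (hn : 1 ≤ n) (s t : I) :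
    pullEnds (alpha (s, n), t) = alpha (seg s (stretch s) t, n) := by
  have : n ≠ 0 := by lia
  simp [pullEnds, this]

theorem exists_contractible_nhd_base {V : Set HR} (hV : IsOpen V) {u : I}
    (hu : alpha (u, 0) ∈ V) :
    ∃ O ⊆ V, IsOpen O ∧ alpha (u, 0) ∈ O ∧ ContractibleSpace O := by
  obtain ⟨ε, hε, hball⟩ := Metric.isOpen_iff.1 (isOpen_HR_iff.1 hV 0) u hu
  set J := Metric.ball u ε with hJ
  -- The length of the ends inside `V` depends on the rope, with no uniform lower bound. The cap
  -- `1/3` keeps the two ends disjoint and inside the region where `stretch` is constant.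
  have (n : ℕ) : ∃ δ : ℝ, 0 < δ ∧ δ ≤ 1 / 3 ∧
      (1 ≤ n → (0 : I) ∈ J → ∀ s : I, s < δ → alpha (s, n) ∈ V) ∧
      (1 ≤ n → unitFrac n ∈ J → ∀ s : I, 1 - δ < s → alpha (s, n) ∈ V) := by
    have key (P : Prop) (a : I) (h : P → alpha (a, n) ∈ V) :
        ∃ δ : ℝ, 0 < δ ∧ (P → ∀ s : I, dist s a < δ → alpha (s, n) ∈ V) := by
      by_cases hP : P
      · obtain ⟨δ, hδ, hs⟩ := Metric.isOpen_iff.1 (isOpen_HR_iff.1 hV n) a (h hP)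
        exact ⟨δ, hδ, fun _ s h => hs h⟩
      · exact ⟨1, one_pos, fun h => absurd h hP⟩
    obtain ⟨δ₀, hδ₀, h₀⟩ := key ((0 : I) ∈ J) 0 (fun h => by rw [alpha_zero]; exact hball h)
    obtain ⟨δ₁, hδ₁, h₁⟩ := key (1 ≤ n ∧ unitFrac n ∈ J) 1
      (fun h => by rw [alpha_one h.1]; exact hball h.2)
    refine ⟨min (1 / 3) (min δ₀ δ₁), by positivity, min_le_left _ _, fun _ h s hs => h₀ h s ?_,
      fun hn h s hs => h₁ ⟨hn, h⟩ s ?_⟩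
    · rw [Subtype.dist_eq, Real.dist_eq, Set.Icc.coe_zero, sub_zero, abs_of_nonneg s.2.1]
      exact hs.trans_le ((min_le_right _ _).trans (min_le_left _ _))
    · rw [Subtype.dist_eq, Real.dist_eq, Set.Icc.coe_one, abs_sub_comm,
        abs_of_nonneg (by linarith [s.2.2])]
      have : min (1 / 3) (min δ₀ δ₁) ≤ δ₁ := (min_le_right _ _).trans (min_le_right _ _)
      linarith
  choose δ hδ hδ3 hV₀ hV₁ using this
  let O : Set HR := HR.mkSet (fun n => if n = 0 then J else
      {s : I | (0 : I) ∈ J ∧ (s : ℝ) < δ n} ∪ {s : I | unitFrac n ∈ J ∧ 1 - δ n < s})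
    (fun n hn => by
      have : n ≠ 0 := by lia
      have h1 : ¬ (1 < δ n) := by linarith [hδ3 n]
      simp [this, hδ n, h1])
    (fun n hn => by
      have : n ≠ 0 := by lia
      have h1 : ¬ (1 < δ n) := by linarith [hδ3 n]
      simp [this, hδ n, h1])
  have hbase {v : I} : alpha (v, 0) ∈ O ↔ v ∈ J := Iff.rfl
  have hrope {n : ℕ} (hn : 1 ≤ n) {s : I} : alpha (s, n) ∈ O ↔
      ((0 : I) ∈ J ∧ (s : ℝ) < δ n) ∨ (unitFrac n ∈ J ∧ 1 - δ n < s) := by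
    have : n ≠ 0 := by lia
    rw [HR.alpha_mem_mkSet, if_neg this]
    rfl
  have huO : alpha (u, 0) ∈ O := hbase.2 (Metric.mem_ball_self hε)
  refine ⟨O, fun x hx => ?_, HR.isOpen_mkSet fun n => ?_, huO, ?_⟩
  · obtain ⟨⟨s, n⟩, rfl⟩ := alpha_surjective x
    rcases Nat.eq_zero_or_pos n with rfl | hn
    · exact hball hx
    · rcases (hrope hn).1 hx with h | h
      · exact hV₀ n hn h.1 s h.2
      · exact hV₁ n hn h.1 s h.2
  · split_ifs
    · exact Metric.isOpen_ball
    · exact (isOpen_const.inter (isOpen_Iio.preimage continuous_subtype_val)).union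
        (isOpen_const.inter (isOpen_Ioi.preimage continuous_subtype_val))
  have hpos {x : HR} (hx : x ∈ O) : pos x ∈ J ∧ pullEnds (x, 1) = alpha (pos x, 0) := by
    obtain ⟨⟨s, n⟩, rfl⟩ := alpha_surjective x
    rcases Nat.eq_zero_or_pos n with rfl | hn
    · exact ⟨hx, rfl⟩
    · rw [pos_rope hn, pullEnds_rope hn, seg_one]
      rcases (hrope hn).1 hx with h | h
      · rw [stretch_of_le (by linarith [hδ3 n]), zero_mul, alpha_zero]
        exact ⟨h.1, rfl⟩
      · rw [stretch_of_ge (by linarith [hδ3 n]), one_mul, alpha_one hn]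
        exact ⟨h.1, rfl⟩
  -- First the rope ends are pulled to the base interval, then the trace on the base is contracted
  -- affinely to `u`.
  refine contractibleSpace_of_homotopies pullEnds
    ⟨fun p => alpha (seg (pos p.1) u p.2, 0), by fun_prop⟩ huO ?_ ?_ ?_ ?_ ?_
  · intro x hx t
    obtain ⟨⟨s, n⟩, rfl⟩ := alpha_surjective x
    rcases Nat.eq_zero_or_pos n with rfl | hn
    · exact hx
    · rw [pullEnds_rope hn, hrope hn, coe_seg]
      rcases (hrope hn).1 hx with h | h
      · rw [stretch_of_le (by linarith [hδ3 n]), Set.Icc.coe_zero]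
        refine .inl ⟨h.1, ?_⟩
        nlinarith [s.2.1, t.2.1]
      · rw [stretch_of_ge (by linarith [hδ3 n]), Set.Icc.coe_one]
        refine .inr ⟨h.1, ?_⟩
        nlinarith [s.2.2, t.2.1]
  · intro x hx t
    exact hbase.2 ((dist_seg_le _ _ _).trans_lt (hpos hx).1)
  · intro x hx
    obtain ⟨⟨s, n⟩, rfl⟩ := alpha_surjective x
    rcases Nat.eq_zero_or_pos n with rfl | hn
    · rfl
    · rw [pullEnds_rope hn, seg_zero]
  · intro x hx
    simpa using (hpos hx).2
  · intro x hx
    simp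

theorem exists_contractible_nhd_HR {V : Set HR} (hV : IsOpen V) {x : HR} (hx : x ∈ V) :
    ∃ O ⊆ V, IsOpen O ∧ x ∈ O ∧ ContractibleSpace O := by
  rcases base_or_rope x with ⟨u, rfl⟩ | ⟨n, hn, s, h0, h1, rfl⟩
  · exact exists_contractible_nhd_base hV hx
  · exact exists_contractible_nhd_rope hV hn h0 h1 hx

/-- The contraction of the cone to its vertex. -/
def coneContraction : C(X × I, X) :=
  (X.lift (ContinuousMap.curry ⟨fun p : (HR × I) × I => q (p.1.1, p.1.2 * σ p.2), by fun_prop⟩)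
    (by
      intro x y
      ext t
      simp only [ContinuousMap.curry_apply, ContinuousMap.coe_mk, zero_mul]
      exact collapseMap_eq ⟨trivial, rfl⟩ ⟨trivial, rfl⟩)).uncurry

theorem coneContraction_q (x : HR) (t r : I) : coneContraction (q (x, t), r) = q (x, t * σ r) := rfl

theorem q_zero_eq (x y : HR) : q (x, 0) = q (y, 0) := collapseMap_eq ⟨trivial, rfl⟩ ⟨trivial, rfl⟩

theorem coneContraction_zero (z : X) : coneContraction (z, 0) = z := by
  obtain ⟨⟨x, t⟩, rfl⟩ := q_surjective z
  simp [coneContraction_q]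

theorem coneContraction_one (z : X) (y : HR) : coneContraction (z, 1) = q (y, 0) := by
  obtain ⟨⟨x, t⟩, rfl⟩ := q_surjective z
  simp [coneContraction_q, q_zero_eq x y]

theorem exists_contractible_nhd_vertex {V : Set X} (hV : IsOpen V) {y : HR} (hy : q (y, 0) ∈ V) :
    ∃ O ⊆ V, IsOpen O ∧ q (y, 0) ∈ O ∧ ContractibleSpace O := by
  have hyO : ∀ r, coneContraction (q (y, 0), r) ∈ V := fun r => by
    rwa [coneContraction_q, zero_mul]
  -- The points whose whole segment to the vertex stays in `V`. This set is open by compactness of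
  -- `I`, and stable under the contraction because its stages compose multiplicatively.
  refine ⟨{z | ∀ r, coneContraction (z, r) ∈ V}, fun z hz => ?_, ?_, hyO, ?_⟩
  · simpa [coneContraction_zero] using hz 0
  · have := (ContinuousMap.isOpen_setOfPred_mapsTo (isCompact_univ (X := I)) hV).preimage
      coneContraction.curry.continuous
    convert! this using 1
    ext z
    simp [Set.MapsTo]
  · refine contractibleSpace_of_homotopy coneContraction hyO ?_
      (fun z _ => coneContraction_zero z) (fun z _ => coneContraction_one z y)
    intro z hz t r
    obtain ⟨⟨x, s⟩, rfl⟩ := q_surjective z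
    have := hz (σ (σ t * σ r))
    simpa [coneContraction_q, mul_assoc] using this

theorem exists_contractible_nhd_X {V : Set X} (hV : IsOpen V) {z : X} (hz : z ∈ V) :
    ∃ O ⊆ V, IsOpen O ∧ z ∈ O ∧ ContractibleSpace O := by
  obtain ⟨⟨x, t⟩, rfl⟩ := q_surjective z
  rcases eq_or_ne t 0 with rfl | ht
  · exact exists_contractible_nhd_vertex hV hz
  obtain ⟨O₁, J, hO₁, hJ, hx, htJ, hsub⟩ := isOpen_prod_iff.1 (hV.preimage q.continuous) x t hz
  obtain ⟨O, hOO, hO, hxO, hc⟩ := exists_contractible_nhd_HR hO₁ hx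
  obtain ⟨ε, hε, hball⟩ := Metric.isOpen_iff.1 (hJ.inter isOpen_compl_singleton) t ⟨htJ, ht⟩
  have hW : IsOpen (O ×ˢ Metric.ball t ε) := hO.prod Metric.isOpen_ball
  have hd : Disjoint (O ×ˢ Metric.ball t ε) (Set.univ ×ˢ {0}) :=
    Set.disjoint_left.2 fun p hp hp' => (hball hp.2).2 hp'.2
  have hemb : Topology.IsOpenEmbedding fun w : O ×ˢ Metric.ball t ε => q w :=
    isOpenEmbedding_collapseMap hW hd
  refine ⟨Set.range fun w : O ×ˢ Metric.ball t ε => q w, ?_, hemb.isOpen_range,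
    ⟨⟨(x, t), hxO, Metric.mem_ball_self hε⟩, rfl⟩, ?_⟩
  · rintro _ ⟨⟨p, hp⟩, rfl⟩
    exact hsub ⟨hOO hp.1, (hball hp.2).1⟩
  · have := contractibleSpace_ball t hε
    exact (hemb.isEmbedding.toHomeomorph.symm.trans (Homeomorph.Set.prod _ _)).contractibleSpace

theorem hasBasis_contractible (x : X) : (𝓝 x).HasBasis
    (fun V : Set X => IsOpen V ∧ x ∈ V ∧ ContractibleSpace V) id := by
  refine (nhds_basis_opens x).to_hasBasis (fun V hV => ?_) fun V hV => ⟨V, ⟨hV.2.1, hV.1⟩, le_rfl⟩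
  obtain ⟨O, hOV, hO, hxO, hc⟩ := exists_contractible_nhd_X hV.2 hV.1
  exact ⟨O, ⟨hO, hxO, hc⟩, hOV⟩

theorem stronglyLocallyContractibleSpace_X : StronglyLocallyContractibleSpace X :=
  .of_bases hasBasis_contractible fun _ _ h => h.2.2

instance : ContractibleSpace X := by
  have := contractibleSpace_of_homotopy coneContraction (Set.mem_univ (q (alpha (0, 0), 0)))
    (fun _ _ _ => trivial) (fun z _ => coneContraction_zero z) (fun z _ => coneContraction_one z _)
  exact (Homeomorph.Set.univ X).symm.contractibleSpace

/-! ### Weak contractibility of the union of the ropes -/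

/-- A map of the unit interval fixing the endpoints and sending the outer quarters to them. -/
noncomputable def squeeze : C(I, I) :=
  ⟨fun s => Set.projIcc 0 1 zero_le_one (2 * (s : ℝ) - 1 / 2), by fun_prop⟩

/-- A function which vanishes at the endpoints and is `1` on the middle half of the interval. -/
noncomputable def plateau : C(I, I) :=
  ⟨fun s => Set.projIcc 0 1 zero_le_one (min (4 * (s : ℝ)) (4 - 4 * s)), by fun_prop⟩

theorem squeeze_zero : squeeze 0 = 0 := Set.projIcc_of_le_left zero_le_one (by norm_num)

theorem squeeze_one : squeeze 1 = 1 := Set.projIcc_of_right_le zero_le_one (by norm_num)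

theorem plateau_zero : plateau 0 = 0 := Set.projIcc_of_le_left zero_le_one (by norm_num)

theorem plateau_one : plateau 1 = 0 := Set.projIcc_of_le_left zero_le_one (by norm_num)

theorem plateau_eq_one {s : I} (h0 : squeeze s ≠ 0) (h1 : squeeze s ≠ 1) : plateau s = 1 := by
  refine Set.projIcc_of_right_le zero_le_one (le_min ?_ ?_)
  · by_contra! h
    exact h0 (Set.projIcc_of_le_left zero_le_one (by linarith))
  · by_contra! h
    exact h1 (Set.projIcc_of_right_le zero_le_one (by linarith))

open Topology.Homotopy in
/-- A generalized loop whose image is freely contracted by a homotopy is null-homotopic. -/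
theorem genLoop_homotopic_const {N Y : Type*} [Fintype N] [Nonempty N] [TopologicalSpace Y] {y : Y}
    (f : Ω^ N Y y) (C : C(Y × I, Y)) {c : Y} (h₀ : ∀ x, C (f x, 0) = f x)
    (h₁ : ∀ x, C (f x, 1) = c) : GenLoop.Homotopic f GenLoop.const := by
  let r : C(N → I, N → I) := ⟨fun x i => squeeze (x i), by fun_prop⟩
  let u : C(N → I, I) := ⟨fun x => ∏ i, plateau (x i), by fun_prop⟩
  have hu : ∀ x ∈ Cube.boundary N, u x = 0 := by
    rintro x ⟨i, h | h⟩
    · exact Finset.prod_eq_zero (Finset.mem_univ i) (by rw [h, plateau_zero])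
    · exact Finset.prod_eq_zero (Finset.mem_univ i) (by rw [h, plateau_one])
  have hu1 : ∀ x, r x ∉ Cube.boundary N → u x = 1 := fun x hx =>
    Finset.prod_eq_one fun i _ => plateau_eq_one (fun h => hx ⟨i, .inl h⟩)
      (fun h => hx ⟨i, .inr h⟩)
  have hfy : ∀ x ∈ Cube.boundary N, f x = y := f.2
  -- The free contraction moves the base point along the path `C (y, ·)`. To repair this, `f` is
  -- first made constant on a collar of the cube (`f₁`); the contraction is then damped by `u` to
  -- fix the boundary, which leaves that path read along the collar (`f₂`), and finally the path is
  -- retracted to `y`.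
  obtain ⟨i₀⟩ := ‹Nonempty N›
  have hy : f 0 = y := hfy 0 ⟨i₀, .inl rfl⟩
  have hy0 : C (y, 0) = y := by rw [← hy, h₀]
  let f' : C(N → I, Y) := f.1
  let f₁ : C(N → I, Y) := f'.comp r
  let f₂ : C(N → I, Y) := ⟨fun x => C (y, u x), by fun_prop⟩
  have H₁ : f'.HomotopicRel f₁ (Cube.boundary N) :=
    ⟨{ toFun := fun p => f' fun i => seg (p.2 i) (squeeze (p.2 i)) p.1
       continuous_toFun := by fun_prop
       map_zero_left := fun x => by simp
       map_one_left := fun x => by simp [f₁, r]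
       prop' := by
        rintro t x ⟨i, hi⟩
        have hx : f' x = y := hfy x ⟨i, hi⟩
        change (f' fun i => seg (x i) (squeeze (x i)) t) = f' x
        rw [hx]
        refine hfy _ ⟨i, ?_⟩
        rcases hi with h | h
        · exact .inl (by simp only [h, squeeze_zero, seg_self])
        · exact .inr (by simp only [h, squeeze_one, seg_self]) }⟩
  have H₂ : f₁.HomotopicRel f₂ (Cube.boundary N) :=
    ⟨{ toFun := fun p => C (f₁ p.2, p.1 * u p.2)
       continuous_toFun := by fun_prop
       map_zero_left := fun x => by
        simp only [zero_mul]
        exact h₀ (r x)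
       map_one_left := fun x => by
        simp only [one_mul]
        by_cases hx : r x ∈ Cube.boundary N
        · change C (f (r x), u x) = C (y, u x)
          rw [hfy _ hx]
        · change C (f (r x), u x) = C (y, u x)
          rw [hu1 x hx, h₁, ← hy, h₁]
       prop' := by
        intro t x hx
        change C (f (r x), t * u x) = f (r x)
        rw [hu x hx, mul_zero, h₀] }⟩
  have H₃ : f₂.HomotopicRel (.const _ y) (Cube.boundary N) :=
    ⟨{ toFun := fun p => C (y, σ p.1 * u p.2)
       continuous_toFun := by fun_prop
       map_zero_left := fun x => by simp [f₂]
       map_one_left := fun x => by simp [hy0]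
       prop' := by
        intro t x hx
        simp [f₂, hu x hx] }⟩
  exact (H₁.trans H₂).trans H₃

/-- A narrow version of the function `tent n`. -/
noncomputable def spike (n : ℕ) : C(I, I) :=
  ⟨fun u => Set.projIcc 0 1 zero_le_one (2 * (tent n u : ℝ) - 1), by fun_prop⟩

theorem spike_of_le {n : ℕ} {u : I} (h : (tent n u : ℝ) ≤ 1 / 2) : spike n u = 0 :=
  Set.projIcc_of_le_left zero_le_one (by linarith)

theorem spike_unitFrac (n : ℕ) : spike n (unitFrac n) = 1 :=
  Set.projIcc_of_right_le zero_le_one (by rw [tent_unitFrac_self]; norm_num)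

theorem spike_of_le_mid {n : ℕ} (hn : 1 ≤ n) {u : I}
    (h : (u : ℝ) ≤ (1 / n + 1 / (n + 1)) / 2) : spike n u = 0 := by
  have hn' : (1 : ℝ) ≤ n := by exact_mod_cast hn
  refine spike_of_le ?_
  rw [coe_tent]
  refine max_le (by norm_num) ?_
  have h1 : 1 / (n : ℝ) - (1 / n + 1 / (n + 1)) / 2 = 1 / 2 / (n * (n + 1)) := by
    field_simp; ring
  have h2 : 1 / 2 / ((n : ℝ) * (n + 1)) ≤ |(u : ℝ) - 1 / n| := by
    rw [abs_sub_comm]; exact le_trans (by linarith) (le_abs_self _)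
  rw [div_le_iff₀ (by positivity)] at h2
  linarith

theorem spike_succ_mid {n : ℕ} (hn : 1 ≤ n) {u : I}
    (h : (u : ℝ) = (1 / n + 1 / (n + 1)) / 2) : spike (n + 1) u = 0 := by
  have hn' : (1 : ℝ) ≤ n := by exact_mod_cast hn
  refine spike_of_le ?_
  rw [coe_tent]
  refine max_le (by norm_num) ?_
  have h1 : (u : ℝ) - 1 / (n + 1 : ℕ) = 1 / 2 / (n * (n + 1)) := by
    rw [h]; push_cast; field_simp; ring
  rw [h1, abs_of_nonneg (by positivity)]
  have h2 : 1 / 2 / ((n : ℝ) * (n + 1)) * (((n + 1 : ℕ) : ℝ) * ((n + 1 : ℕ) + 1)) =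
      1 / 2 + 1 / n := by
    push_cast; field_simp; ring
  have : 0 ≤ 1 / (n : ℝ) := by positivity
  linarith

/-- Extends over the base interval the motion of the points `1/m`, `m ≤ k + 1`, along their ropes.
Around each `1/m` a spike sends the base out along rope `m`; neighboring spikes vanish at the
midpoint between their centers, so pieces glue there at the starting point. -/
theorem exists_baseContraction (k : ℕ) : ∃ E : C(I × I, HR), (∀ p, E p ∈ A) ∧
    (∀ u t : I, (u : ℝ) ≤ (1 / (k + 1 : ℕ) + 1 / ((k + 1 : ℕ) + 1)) / 2 →
      E (u, t) = alpha (0, 0)) ∧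
    ∀ m t, 1 ≤ m → m ≤ k + 1 → E (unitFrac m, t) = alpha (t, m) := by
  induction k with
  | zero =>
    refine ⟨⟨fun p => alpha (p.2 * spike 1 p.1, 1), by fun_prop⟩, fun p => alpha_mem_A le_rfl _,
      fun u t h => ?_, fun m t h1 h2 => ?_⟩
    · simp only [ContinuousMap.coe_mk]
      rw [spike_of_le_mid le_rfl (by simpa using h), mul_zero, alpha_zero]
    · obtain rfl : m = 1 := by lia
      simp [spike_unitFrac]
  | succ k ih =>
    obtain ⟨E, hA, h0, h1⟩ := ih
    let p : ℝ := (1 / (k + 1 : ℕ) + 1 / ((k + 1 : ℕ) + 1)) / 2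
    have hp1 : 1 / ((k + 2 : ℕ) : ℝ) < p ∧ p < 1 / ((k + 1 : ℕ) : ℝ) := by
      have : 1 / ((k + 1 : ℕ) : ℝ) - 1 / ((k + 1 : ℕ) + 1) =
        1 / ((k + 1 : ℕ) * ((k + 1 : ℕ) + 1)) := by field_simp; ring
      have h2 : 0 < 1 / (((k + 1 : ℕ) : ℝ) * ((k + 1 : ℕ) + 1)) := by positivity
      have h3 : ((k + 2 : ℕ) : ℝ) = (k + 1 : ℕ) + 1 := by push_cast; ring
      rw [h3]
      constructor <;> simp only [p] <;> linarith
    have hc : Continuous fun z : I × I => if (z.1 : ℝ) ≤ p then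
        alpha (z.2 * spike (k + 2) z.1, k + 2) else E z := by
      refine Continuous.if_le (by fun_prop) (by fun_prop) (by fun_prop) (by fun_prop) ?_
      rintro ⟨u, t⟩ h
      rw [h0 u t h.le, spike_succ_mid (n := k + 1) (by lia) h, mul_zero, alpha_zero]
    refine ⟨⟨_, hc⟩, fun z => ?_, fun u t h => ?_, fun m t hm hmk => ?_⟩
    · simp only [ContinuousMap.coe_mk]
      split_ifs
      · exact alpha_mem_A (by lia) _
      · exact hA z
    · have h2 : (u : ℝ) ≤ p := by
        refine h.trans ?_
        simp only [p]
        have : (1 : ℝ) / ((k + 1 + 1 : ℕ) : ℝ) ≤ 1 / (k + 1 : ℕ) := by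
          gcongr
          lia
        have h3 : (1 : ℝ) / (((k + 1 + 1 : ℕ) : ℝ) + 1) ≤ 1 / ((k + 1 : ℕ) + 1) := by
          gcongr
          lia
        linarith
      simp only [ContinuousMap.coe_mk, if_pos h2]
      rw [spike_of_le_mid (by lia) h, mul_zero, alpha_zero]
    · rcases Nat.lt_or_ge m (k + 2) with h | h
      · have h2 : ¬ ((unitFrac m : I) : ℝ) ≤ p := by
          rw [not_le, coe_unitFrac]
          refine hp1.2.trans_le ?_
          gcongr
          lia
        simp only [ContinuousMap.coe_mk, if_neg h2]
        exact h1 m t hm (by lia)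
      · obtain rfl : m = k + 2 := by lia
        have h2 : ((unitFrac (k + 2) : I) : ℝ) ≤ p := by
          rw [coe_unitFrac]
          exact hp1.1.le
        simp only [ContinuousMap.coe_mk, if_pos h2]
        rw [spike_unitFrac, mul_one]

/-- Long ropes use `s ⊓ σ s` in place of `s`: their far end stays at the starting point throughout,
which matches `E` near `0`, while the first half still ends at the identity. -/
theorem exists_ropeContraction (k : ℕ) : ∃ C : C(HR × I, HR), (∀ p, C p ∈ A) ∧
    (∀ x ∈ A, C (x, 0) = alpha (0, 0)) ∧
    (∀ n s, 1 ≤ n → n ≤ k + 1 → C (alpha (s, n), 1) = alpha (s, n)) ∧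
    ∀ n (s : I), 1 ≤ n → (s : ℝ) ≤ 1 / 2 → C (alpha (s, n), 1) = alpha (s, n) := by
  obtain ⟨E, hA, h0, h1⟩ := exists_baseContraction k
  let φ : ℕ → C(I × I, HR) := fun n => if n = 0 then E else if n ≤ k + 1 then
    ⟨fun p => alpha (p.2 * p.1, n), by fun_prop⟩ else
    ⟨fun p => alpha (p.2 * (p.1 ⊓ σ p.1), n), by fun_prop⟩
  have φ0 : φ 0 = E := if_pos rfl
  have φ1 {n : ℕ} (hn : 1 ≤ n) (hnk : n ≤ k + 1) (s t : I) : φ n (s, t) = alpha (t * s, n) := by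
    have : n ≠ 0 := by lia
    simp [φ, this, hnk]
  have φ2 {n : ℕ} (hnk : ¬ n ≤ k + 1) (s t : I) :
      φ n (s, t) = alpha (t * (s ⊓ σ s), n) := by
    have : n ≠ 0 := by lia
    simp [φ, this, hnk]
  let C : C(HR × I, HR) := HR.liftProd φ
    (fun n hn t => by
      rw [φ0, h0 0 t (by rw [Set.Icc.coe_zero]; positivity)]
      by_cases h : n ≤ k + 1
      · rw [φ1 hn h, mul_zero, alpha_zero]
      · rw [φ2 h, show (0 : I) ⊓ σ 0 = 0 from inf_eq_left.2 unitInterval.nonneg', mul_zero,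
          alpha_zero])
    (fun n hn t => by
      rw [φ0]
      by_cases h : n ≤ k + 1
      · rw [φ1 hn h, mul_one, h1 n t hn h]
      · rw [φ2 h, show (1 : I) ⊓ σ 1 = 0 by simp, mul_zero, alpha_zero, h0]
        rw [coe_unitFrac]
        have h2 : 1 / (n : ℝ) ≤ 1 / (((k + 1 : ℕ) : ℝ) + 1) := by
          have : k + 1 + 1 ≤ n := by lia
          gcongr
          exact_mod_cast this
        have h3 : 1 / (((k + 1 : ℕ) : ℝ) + 1) ≤ 1 / (k + 1 : ℕ) := by
          gcongr
          linarith
        linarith)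
  have hC (s t : I) (n : ℕ) : C (alpha (s, n), t) = φ n (s, t) := rfl
  refine ⟨C, ?_, ?_, ?_, ?_⟩
  · rintro ⟨x, t⟩
    obtain ⟨⟨s, n⟩, rfl⟩ := alpha_surjective x
    rw [hC]
    rcases Nat.eq_zero_or_pos n with rfl | hn
    · rw [φ0]; exact hA _
    by_cases h : n ≤ k + 1
    · rw [φ1 hn h]; exact alpha_mem_A hn _
    · rw [φ2 h]; exact alpha_mem_A hn _
  · intro x hx
    obtain ⟨n, hn, s, rfl⟩ := mem_A_iff.1 hx
    rw [hC]
    by_cases h : n ≤ k + 1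
    · rw [φ1 hn h, zero_mul, alpha_zero]
    · rw [φ2 h, zero_mul, alpha_zero]
  · intro n s hn h
    rw [hC, φ1 hn h, one_mul]
  · intro n s hn hs
    rw [hC]
    by_cases h : n ≤ k + 1
    · rw [φ1 hn h, one_mul]
    · rw [φ2 h, one_mul, inf_eq_left.2]
      change (s : ℝ) ≤ 1 - s
      linarith

theorem exists_contraction_of_compact {K : Type*} [TopologicalSpace K] [CompactSpace K]
    [ConnectedSpace K] (f : C(K, A)) : ∃ C : C(A × I, A), (∀ x, C (f x, 0) = f x) ∧
    ∀ x, C (x, 1) = ⟨alpha (0, 0), zero_mem_A⟩ := by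
  obtain ⟨x₀⟩ : Nonempty K := inferInstance
  obtain ⟨k, hk, s₀, hs₀⟩ := mem_A_iff.1 (f x₀).2
  obtain ⟨B, hB⟩ := (isCompact_range (f := fun x => height (f x)) (by fun_prop)).bddAbove
  obtain ⟨N, hN⟩ := exists_nat_gt B
  obtain ⟨C, hCA, hC0, hC1, hC2⟩ := exists_ropeContraction (k + N)
  refine ⟨⟨fun p => ⟨C (p.1, σ p.2), hCA _⟩, by fun_prop⟩, fun x => ?_, fun x => ?_⟩
  · obtain ⟨n, hn, s, hs⟩ := mem_A_iff.1 (f x).2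
    refine Subtype.ext ?_
    simp only [ContinuousMap.coe_mk, unitInterval.symm_zero]
    rw [hs]
    rcases le_or_gt n (k + N + 1) with h | h
    · exact hC1 n s hn h
    refine hC2 n s hn ?_
    -- If the image passed the midpoint of a rope this long, connectedness to `f x₀` on another rope
    -- would force it through that midpoint, where the height `n` exceeds the bound `B`.
    by_contra! hlt
    have hc : Continuous fun x => (ropeCoord n hn (f x) : ℝ) := by fun_prop
    have h1 : (ropeCoord n hn (f x₀) : ℝ) ≤ 1 / 2 := by
      rw [hs₀, ropeCoord_of_ne hn hk (by lia)]; norm_num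
    have h2 : 1 / 2 ≤ (ropeCoord n hn (f x) : ℝ) := by
      rw [hs, ropeCoord_rope]; exact hlt.le
    obtain ⟨z, hz⟩ := intermediate_value_univ x₀ x hc ⟨h1, h2⟩
    obtain ⟨j, hj, t, ht⟩ := mem_A_iff.1 (f z).2
    simp only [ht] at hz
    rcases eq_or_ne j n with rfl | hjn
    · rw [ropeCoord_rope] at hz
      have h3 := hB ⟨z, rfl⟩
      simp only [ht, height_alpha, hz] at h3
      have h4 : (N : ℝ) ≤ j := by exact_mod_cast (by lia : N ≤ j)
      linarith
    · rw [ropeCoord_of_ne hn hj hjn] at hz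
      norm_num at hz
  · refine Subtype.ext ?_
    simp only [ContinuousMap.coe_mk, unitInterval.symm_one]
    exact hC0 x x.2

theorem image_top (S : Set HR) : (fun x => q (x, 1)) '' S = q '' (S ×ˢ {1}) := by
  ext z
  constructor
  · rintro ⟨x, hx, rfl⟩
    exact ⟨(x, 1), ⟨hx, rfl⟩, rfl⟩
  · rintro ⟨⟨x, _⟩, ⟨hx, rfl⟩, rfl⟩
    exact ⟨x, hx, rfl⟩

/-- The top of the cone is a closed copy of the Hawaiian ropes. -/
theorem isClosedEmbedding_top : Topology.IsClosedEmbedding fun x : HR => q (x, 1) := by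
  refine .of_continuous_injective_isClosedMap (by fun_prop) ?_ ?_
  · intro x y hxy
    rcases collapseMap_eq_iff.1 hxy with h | h
    · exact congrArg Prod.fst h
    · exact absurd h.1.2 one_ne_zero
  · intro C hC
    rw [image_top]
    exact isClosedMap_q _ (hC.prod isClosed_singleton)

/-- The homeomorphism between the union of the ropes and its copy in the cone. -/
noncomputable def homeomorphA' : A ≃ₜ A' :=
  (isClosedEmbedding_top.isEmbedding.homeomorphImage A).trans
    (Homeomorph.setCongr (image_top A))

theorem exists_contraction_of_compact' {K : Type*} [TopologicalSpace K] [CompactSpace K]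
    [ConnectedSpace K] (f : C(K, A')) : ∃ C : C(A' × I, A'), (∀ x, C (f x, 0) = f x) ∧
    ∀ x, C (x, 1) = homeomorphA' ⟨alpha (0, 0), zero_mem_A⟩ := by
  obtain ⟨C, h0, h1⟩ := exists_contraction_of_compact
    (⟨fun x => homeomorphA'.symm (f x), by fun_prop⟩ : C(K, A))
  refine ⟨⟨fun p => homeomorphA' (C (homeomorphA'.symm p.1, p.2)), by fun_prop⟩, fun x => ?_,
    fun x => ?_⟩
  · have := h0 x
    simp only [ContinuousMap.coe_mk] at this ⊢
    rw [this, Homeomorph.apply_symm_apply]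
  · simp only [ContinuousMap.coe_mk, h1]

theorem weaklyContractible_A' : WeaklyContractible A' := by
  refine ⟨⟨homeomorphA' ⟨alpha (0, 0), zero_mem_A⟩⟩, fun n y => ?_⟩
  rcases n with _ | n
  · have hj (x : A') : Joined x (homeomorphA' ⟨alpha (0, 0), zero_mem_A⟩) := by
      obtain ⟨C, h0, h1⟩ := exists_contraction_of_compact' (ContinuousMap.const Unit x)
      exact ⟨⟨⟨fun t => C (x, t), by fun_prop⟩, h0 (), h1 x⟩⟩
    have : Subsingleton (ZerothHomotopy A') :=
      ⟨fun a b => Quotient.inductionOn₂ a b fun x y => Quotient.sound ((hj x).trans (hj y).symm)⟩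
    exact HomotopyGroup.pi0EquivZerothHomotopy.subsingleton
  · have key (a : HomotopyGroup.Pi (n + 1) A' y) :
        a = Quotient.mk (GenLoop.Homotopic.setoid _ _) GenLoop.const := by
      induction a using Quotient.inductionOn with
      | h f =>
        obtain ⟨C, h0, h1⟩ := exists_contraction_of_compact' f.1
        exact Quotient.sound (genLoop_homotopic_const f C h0 fun x => h1 _)
    exact ⟨fun a b => (key a).trans (key b).symm⟩

end HawaiianRopes

theorem mainTheorem3 :
    -- the cone `X` on the Hawaiian ropes
    ContractibleSpace HawaiianRopes.X ∧
    StronglyLocallyContractibleSpace HawaiianRopes.X ∧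
    (∀ x : HawaiianRopes.X, (𝓝 x).HasBasis
      (fun V : Set HawaiianRopes.X => IsOpen V ∧ x ∈ V ∧ ContractibleSpace V) id) ∧
    T2Space HawaiianRopes.X ∧
    NormalSpace HawaiianRopes.X ∧
    ¬ TopologicalSpace.MetrizableSpace HawaiianRopes.X ∧
    -- the subspace `A'`
    IsClosed HawaiianRopes.A' ∧
    HawaiianRopes.WeaklyContractible HawaiianRopes.A' ∧
    -- the quotient `X / A'`
    Uncountable (HawaiianRopes.H1 (HawaiianRopes.Collapse HawaiianRopes.A')) ∧
    -- creation of fundamental group by the quotient map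
    (∀ x : HawaiianRopes.X, Subsingleton (FundamentalGroup HawaiianRopes.X x)) ∧
    (∀ y : HawaiianRopes.Collapse HawaiianRopes.A',
      Uncountable (FundamentalGroup (HawaiianRopes.Collapse HawaiianRopes.A') y)) ∧
    (∀ x : HawaiianRopes.X, ¬ Function.Surjective
      (FundamentalGroup.map (HawaiianRopes.collapseMap HawaiianRopes.A') x)) := by
  have hsub (x : HawaiianRopes.X) : Subsingleton (FundamentalGroup HawaiianRopes.X x) :=
    inferInstanceAs (Subsingleton (Path.Homotopic.Quotient x x))
  have hpc : PathConnectedSpace (HawaiianRopes.Collapse HawaiianRopes.A') :=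
    (HawaiianRopes.collapseMap_surjective HawaiianRopes.A').pathConnectedSpace
      (HawaiianRopes.collapseMap HawaiianRopes.A').continuous
  have hunc := HawaiianRopes.uncountable_fundamentalGroup_collapse
  refine ⟨inferInstance, HawaiianRopes.stronglyLocallyContractibleSpace_X,
    HawaiianRopes.hasBasis_contractible, inferInstance, inferInstance,
    HawaiianRopes.not_metrizableSpace_X, HawaiianRopes.isClosed_A',
    HawaiianRopes.weaklyContractible_A', HawaiianRopes.uncountable_H1_collapse, hsub, hunc,
    fun x hx => ?_⟩
  have := hsub x
  have := hunc (HawaiianRopes.collapseMap HawaiianRopes.A' x)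
  -- A surjection from a trivial group would make the uncountable target countable.
  exact not_countable (hx.countable)
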